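/- \textbf{Fast QMA amplification.} A quantum verifier $V$ with $n$ witness qubits, $m$ ancilla qubits and a designated output qubit is a unitary on $n+m$ qubits; its acceptance probability on an $n$-qubit witness state $|\psi\rangle$ is the probability that measuring the output qubit of $V|\psi\rangle|0\rangle^{\otimes m}$ gives $1$. $V$ satisfies the promise with bounds $a>b$ if some witness state is accepted with probability at least $a$ (yes case), or every witness state is accepted with probability at most $b$ (no case). There is a polynomial $q$ such that for all $n,m$ (with a choice of output qubit among the $n+m$ qubits), all reals $0\le b<a\le 1$ and all integers $r\ge 0$ the following holds. There is a circuit $V'$ with the same $n$ witness qubits and at most $q(n+m+r+\frac1{a-b})$ ancilla qubits (so polynomially many in $n$ when $m$, $r$ and $\frac1{a-b}$ are polynomially bounded in $n$), consisting of at most $q(n+m+r+\frac1{a-b})$ steps, each an elementary gate (a unitary on at most three qubits) or an evaluation of $V$ or of $V^\dagger$ as a black box, and in which the total number of evaluations of $V$ and $V^\dagger$ is at most $$\frac{10\pi(\sqrt a+\sqrt b)\,r}{a-b}=O\!\left(\frac{r}{a-b}\right).$$ The circuit depends only on $n,m$, the output qubit, $a,b,r$, and not on $V$, and for every unitary $V$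 on the $n+m$ qubits: \begin{itemize} \item if some witness state is accepted by $V$ with probability at least $a$, then some witness state is accepted by $V'$ with probability at least $1-e^{-r}$; \item if every witness state is accepted by $V$ with probability at most $b$, then every witness state is accepted by $V'$ with probability at most $e^{-r}$. \end{itemize} -/

import Mathlib

namespace QMA

/-- Let a matrix `U` on a register of qubits indexed by `S` act on the qubits `e s` of a larger
register indexed by `W`, and as the identity on all other qubits. Computational basis states of
a register `W` are the functions `W → Bool`. -/
def onQubits {S W : Type} [Fintype S] [DecidableEq W] [Fintype W] (e : S ↪ W)
    (U : Matrix (S → Bool) (S → Bool) ℂ) : Matrix (W → Bool) (W → Bool) ℂ :=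
  fun x y => if ∀ w, (∀ s, e s ≠ w) → x w = y w then U (x ∘ e) (y ∘ e) else 0

section Unitarity

variable {S W : Type} [Fintype S] [DecidableEq S] [Fintype W] [DecidableEq W]

theorem onQubits_mul (e : S ↪ W) (A B : Matrix (S → Bool) (S → Bool) ℂ) :
    onQubits e A * onQubits e B = onQubits e (A * B) := by
  ext x y
  rw [Matrix.mul_apply]
  by_cases hxy : ∀ w, (∀ s, e s ≠ w) → x w = y w
  · rw [onQubits, if_pos hxy, Matrix.mul_apply]
    symm
    have hcomp : ∀ t : S → Bool, Function.extend e t x ∘ e = t := fun t =>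
      Function.extend_comp e.injective t x
    have hoff : ∀ (t : S → Bool) (w : W), (∀ s, e s ≠ w) → Function.extend e t x w = x w := by
      intro t w hw
      exact Function.extend_apply' _ _ _ (by rintro ⟨s, hs⟩; exact hw s hs)
    refine Fintype.sum_of_injective (fun t : S → Bool => Function.extend e t x) ?_ _ _ ?_ ?_
    · intro t t' h
      rw [← hcomp t, ← hcomp t']
      exact congrArg (fun f => f ∘ e) h
    · intro z hz
      have : ¬ ∀ w, (∀ s, e s ≠ w) → x w = z w := by
        intro h
        apply hz
        refine ⟨z ∘ e, ?_⟩
        funext w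
        by_cases hw : ∃ s, e s = w
        · obtain ⟨s, rfl⟩ := hw
          exact congrFun (hcomp (z ∘ e)) s
        · have hw' : ∀ s, e s ≠ w := fun s hs => hw ⟨s, hs⟩
          exact (hoff _ w hw').trans (h w hw')
      simp only [onQubits, if_neg this, zero_mul]
    · intro t
      have h1 : ∀ w, (∀ s, e s ≠ w) → x w = Function.extend e t x w :=
        fun w hw => (hoff t w hw).symm
      have h2 : ∀ w, (∀ s, e s ≠ w) → Function.extend e t x w = y w :=
        fun w hw => (hoff t w hw).trans (hxy w hw)
      simp only [onQubits, if_pos h1, if_pos h2, hcomp]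
  · rw [onQubits, if_neg hxy]
    refine Finset.sum_eq_zero fun z _ => ?_
    by_cases h1 : ∀ w, (∀ s, e s ≠ w) → x w = z w
    · have h2 : ¬ ∀ w, (∀ s, e s ≠ w) → z w = y w :=
        fun h2 => hxy fun w hw => (h1 w hw).trans (h2 w hw)
      simp only [onQubits, if_neg h2, mul_zero]
    · simp only [onQubits, if_neg h1, zero_mul]

theorem onQubits_one (e : S ↪ W) :
    onQubits e (1 : Matrix (S → Bool) (S → Bool) ℂ) = 1 := by
  ext x y
  by_cases hxy : x = y
  · subst hxy
    simp [onQubits]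
  · rw [Matrix.one_apply_ne hxy, onQubits]
    split_ifs with h
    · apply Matrix.one_apply_ne
      intro hc
      apply hxy
      funext w
      by_cases hw : ∃ s, e s = w
      · obtain ⟨s, rfl⟩ := hw
        exact congrFun hc s
      · exact h w fun s hs => hw ⟨s, hs⟩
    · rfl

theorem onQubits_star (e : S ↪ W) (A : Matrix (S → Bool) (S → Bool) ℂ) :
    star (onQubits e A) = onQubits e (star A) := by
  ext x y
  have : (∀ w, (∀ s, e s ≠ w) → y w = x w) ↔ (∀ w, (∀ s, e s ≠ w) → x w = y w) :=
    ⟨fun h w hw => (h w hw).symm, fun h w hw => (h w hw).symm⟩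
  simp only [Matrix.star_apply, onQubits, this]
  split_ifs <;> simp

end Unitarity

/-- `onQubits` as an operation on unitary matrices. -/
def liftUnitary {S W : Type} [Fintype S] [DecidableEq S] [Fintype W] [DecidableEq W] (e : S ↪ W)
    (U : Matrix.unitaryGroup (S → Bool) ℂ) : Matrix.unitaryGroup (W → Bool) ℂ :=
  ⟨onQubits e U.1, by
    rw [Matrix.mem_unitaryGroup_iff, onQubits_star, onQubits_mul,
      Matrix.mem_unitaryGroup_iff.1 U.2, onQubits_one]⟩

/-- A quantum verifier with `n` witness qubits and `m` ancilla qubits: the unitary it performs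
and its output qubit, which is measured at the end. -/
structure Verifier (n m : ℕ) where
  U : Matrix.unitaryGroup (Fin n ⊕ Fin m → Bool) ℂ
  out : Fin n ⊕ Fin m

/-- The state `|ψ⟩|0…0⟩`. -/
def withAncillae {n : ℕ} (m : ℕ) (ψ : EuclideanSpace ℂ (Fin n → Bool)) :
    (Fin n ⊕ Fin m → Bool) → ℂ :=
  fun x => if ∀ j, x (Sum.inr j) = false then ψ (fun i => x (Sum.inl i)) else 0

/-- The probability that measuring the output qubit of `V |ψ⟩|0…0⟩` gives `1`. -/
noncomputable def Verifier.acceptProb {n m : ℕ} (V : Verifier n m)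
    (ψ : EuclideanSpace ℂ (Fin n → Bool)) : ℝ :=
  ∑ x : Fin n ⊕ Fin m → Bool,
    if x V.out = true then ‖Matrix.mulVec V.U.1 (withAncillae m ψ) x‖ ^ 2 else 0

/-- Some witness state is accepted with probability at least `p`. -/
def Verifier.AcceptsWith {n m : ℕ} (V : Verifier n m) (p : ℝ) : Prop :=
  ∃ ψ : EuclideanSpace ℂ (Fin n → Bool), ‖ψ‖ = 1 ∧ p ≤ V.acceptProb ψ

/-- Every witness state is accepted with probability at most `p`. -/
def Verifier.SoundWith {n m : ℕ} (V : Verifier n m) (p : ℝ) : Prop :=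
  ∀ ψ : EuclideanSpace ℂ (Fin n → Bool), ‖ψ‖ = 1 → V.acceptProb ψ ≤ p

/-- One step of a circuit on the register `W` that has access to a unitary `V` on a register `S`
as a black box: an elementary gate (a unitary on at most three qubits), one evaluation of `V`, or
one evaluation of `V†`, on any qubits of `W`. -/
inductive Step (S W : Type) : Type where
  | gate (k : ℕ) (hk : k ≤ 3) (e : Fin k ↪ W) (G : Matrix.unitaryGroup (Fin k → Bool) ℂ)
  | evalV (e : S ↪ W)
  | evalVdagger (e : S ↪ W)

section Evaluation

variable {S W : Type} [Fintype S] [DecidableEq S] [Fintype W] [DecidableEq W]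

/-- The unitary performed by a step once the black box is `V`. -/
def Step.unitary (V : Matrix.unitaryGroup (S → Bool) ℂ) :
    Step S W → Matrix.unitaryGroup (W → Bool) ℂ
  | .gate _ _ e G => liftUnitary e G
  | .evalV e => liftUnitary e V
  | .evalVdagger e => liftUnitary e V⁻¹

/-- The unitary performed by a list of steps; the head of the list is performed first. -/
def circuitUnitary (V : Matrix.unitaryGroup (S → Bool) ℂ) :
    List (Step S W) → Matrix.unitaryGroup (W → Bool) ℂ
  | [] => 1
  | s :: l => circuitUnitary V l * s.unitary V

end Evaluation

/-- Number of evaluations of the black box (`1` for `V` and for `V†`, `0` for a gate). -/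
def Step.evals {S W : Type} : Step S W → ℕ
  | .gate _ _ _ _ => 0
  | .evalV _ => 1
  | .evalVdagger _ => 1

/-- A verifier circuit with `n` witness qubits and `m'` ancillae that calls, as a black box,
a verifier with `n` witness qubits and `m` ancillae. -/
structure OracleVerifier (n m m' : ℕ) where
  steps : List (Step (Fin n ⊕ Fin m) (Fin n ⊕ Fin m'))
  out : Fin n ⊕ Fin m'

/-- The verifier obtained when the black box is the unitary `V`. -/
def OracleVerifier.instantiate {n m m' : ℕ} (T : OracleVerifier n m m')
    (V : Matrix.unitaryGroup (Fin n ⊕ Fin m → Bool) ℂ) : Verifier n m' :=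
  ⟨circuitUnitary V T.steps, T.out⟩

/-- Total number of evaluations of `V` and of `V†`. -/
def OracleVerifier.evaluations {n m m' : ℕ} (T : OracleVerifier n m m') : ℕ :=
  (T.steps.map Step.evals).sum

/-- Total number of steps: elementary gates and evaluations of `V` and `V†`. -/
def OracleVerifier.size {n m m' : ℕ} (T : OracleVerifier n m m') : ℕ :=
  T.steps.length

end QMA

/-!
The walk operator `W` of a verifier `V` is the product of two reflections: the one about the
states `|ψ⟩|0…0⟩`, and the one about the rejecting states pulled back through `V`. If `ψ` is an
eigenvector, with eigenvalue `p`, of the operator whose quadratic form is the acceptance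
probability, then `|ψ⟩|0…0⟩` is a combination of eigenvectors of `W` with eigenvalues
`exp (± i φ)`, where `cos φ = 2 p - 1`. What is used is the consequence that the correlations
`⟨0…0|⟨ψ| W ^ j |ψ⟩|0…0⟩` are `cos (j φ)`, which follows from a Chebyshev recurrence without
describing these eigenvectors (`compression_aeval_walk`). Hence `‖P(W) |ψ⟩|0…0⟩‖ ^ 2` is, for any
polynomial `P`, the mean of `‖P(z)‖ ^ 2` over `z = exp (± i φ)`, and it suffices to apply a
polynomial `P` for which this is at least `1 - exp (-r)` when `p ≥ a` and at most `exp (-r)` when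
`p ≤ b`. Passing from `p` to `φ = 2 * arccos (√p)` separates the thresholds by at least
`2 * (√a - √b)`, which is where the quadratic speed-up comes from.

Any pair `P`, `Q` with `‖P‖ ^ 2 + ‖Q‖ ^ 2 = 1` on the unit circle can be applied with `deg P`
controlled uses of `W`, hence `2 * deg P` evaluations of `V` and its adjoint, interleaved with
rotations of one control qubit (`Layout.exists_signal_processing`). The rotations are found by
lowering the degree by one at a time (`exists_rotation_peeling`). The reflection about the
all-zero state of the ancillae is controlled by a chain of three-qubit gates with one flag qubit
for each ancilla (`exists_controlled_reflection`).

To obtain `P`, a power of the Dirichlet kernel is translated over a regular grid on the circle.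
Its squared absolute values add up to a constant by Parseval's identity, so the share contributed
by the grid points near angle `0` is between `0` and `1`, and it is close to a step function
because the kernel is concentrated (`sum_norm_sq_eval_pow_dirichlet_le`). This share and its
complement are sums of squared absolute values of polynomials; after a small shift that makes them
strictly positive, the Fejér–Riesz theorem (`exists_norm_sq_eq_of_pos`) turns each of them into a
single squared absolute value, of `P` and of `Q`.
-/

namespace QMA

open Polynomial ComplexConjugate Matrix

/-! ### Polynomials on the unit circle -/

theorem conj_eq_inv_of_norm_one {z : ℂ} (hz : ‖z‖ = 1) : conj z = z⁻¹ := by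
  rw [Complex.inv_def, Complex.normSq_eq_norm_sq, hz]; simp

theorem ne_zero_of_norm_one {z : ℂ} (hz : ‖z‖ = 1) : z ≠ 0 := by
  rintro rfl; simp at hz

theorem infinite_unit_circle : {z : ℂ | ‖z‖ = 1}.Infinite := by
  have h : Set.InjOn (fun t : ℝ => Complex.exp (t * Complex.I)) (Set.Ioc (-Real.pi) Real.pi) := by
    intro s hs t ht hst
    have h1 := Complex.arg_exp_mul_I s
    have h2 := Complex.arg_exp_mul_I t
    simp only at hst
    rw [hst, h2] at h1
    rwa [(toIocMod_eq_self Real.two_pi_pos).2 (by constructor <;> [exact ht.1; linarith [ht.2]]),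
      (toIocMod_eq_self Real.two_pi_pos).2 (by constructor <;> [exact hs.1; linarith [hs.2]]),
      eq_comm] at h1
  refine ((Set.Ioc_infinite (by linarith [Real.pi_pos])).image h).mono ?_
  rintro _ ⟨t, -, rfl⟩
  exact Complex.norm_exp_ofReal_mul_I t

theorem eq_of_eval_eq_on_circle {p q : ℂ[X]} (h : ∀ z : ℂ, ‖z‖ = 1 → p.eval z = q.eval z) :
    p = q :=
  eq_of_infinite_eval_eq p q (infinite_unit_circle.mono h)

/-- The polynomial `X ^ d * conj (p (1 / conj X))`, whose coefficients are those of `p` (of degree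
at most `d`) conjugated and in reverse order. On the unit circle it is `z ^ d` times the conjugate
of `p`. -/
noncomputable def conjReflect (d : ℕ) (p : ℂ[X]) : ℂ[X] :=
  reflect d (p.map (starRingEnd ℂ))

theorem eval_conjReflect {d : ℕ} {p : ℂ[X]} (hp : p.natDegree ≤ d) {z : ℂ} (hz : z ≠ 0) :
    (conjReflect d p).eval z = z ^ d * conj (p.eval (conj z)⁻¹) := by
  have hp' : (p.map (starRingEnd ℂ)).natDegree ≤ d := natDegree_map_le.trans hp
  let _ : Invertible z⁻¹ := invertibleOfNonzero (inv_ne_zero hz)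
  have h := eval₂_reflect_mul_pow (RingHom.id ℂ) z⁻¹ d (p.map (starRingEnd ℂ)) hp'
  rw [invOf_eq_inv, inv_inv] at h
  have h2 : conj (p.eval (conj z)⁻¹) = (p.map (starRingEnd ℂ)).eval z⁻¹ := by
    rw [← eval₂_id, hom_eval₂, RingHom.comp_id, map_inv₀, Complex.conj_conj, eval_map]
  rw [h2, conjReflect]
  rw [← eval₂_id, ← eval₂_id, ← h, inv_pow]
  field_simp

theorem eval_conjReflect_of_norm_one {d : ℕ} {p : ℂ[X]} (hp : p.natDegree ≤ d) {z : ℂ}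
    (hz : ‖z‖ = 1) : (conjReflect d p).eval z = z ^ d * conj (p.eval z) := by
  rw [eval_conjReflect hp (ne_zero_of_norm_one hz), conj_eq_inv_of_norm_one hz, inv_inv]

theorem coeff_conjReflect {d : ℕ} (p : ℂ[X]) {i : ℕ} (hi : i ≤ d) :
    (conjReflect d p).coeff i = conj (p.coeff (d - i)) := by
  rw [conjReflect, coeff_reflect, revAt_le hi, coeff_map]

theorem natDegree_conjReflect_le {d : ℕ} {p : ℂ[X]} (hp : p.natDegree ≤ d) :
    (conjReflect d p).natDegree ≤ d := by
  refine natDegree_reflect_le.trans ?_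
  exact max_le le_rfl (natDegree_map_le.trans hp)

/-! ### The Fejér–Riesz theorem -/

/-- Fejér–Riesz: a Laurent polynomial `z ^ (-d) * p z` that is strictly positive on the unit
circle is there the squared absolute value of a polynomial. The roots of `p` come in pairs
`w`, `1 / conj w`, and one root of each pair is kept. -/
theorem exists_norm_sq_eq_of_pos (d : ℕ) : ∀ p : ℂ[X], p.natDegree ≤ 2 * d →
    (∀ z : ℂ, ‖z‖ = 1 → ∃ t : ℝ, 0 < t ∧ p.eval z = t * z ^ d) →
    ∃ P : ℂ[X], P.natDegree ≤ d ∧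
      ∀ z : ℂ, ‖z‖ = 1 → p.eval z = ((‖P.eval z‖ ^ 2 : ℝ) : ℂ) * z ^ d := by
  induction d with
  | zero =>
    intro p hp hpos
    have hpC := eq_C_of_natDegree_le_zero (by simpa using hp : p.natDegree ≤ 0)
    obtain ⟨t, ht, hpt⟩ := hpos 1 (by simp)
    rw [hpC] at hpt ⊢
    simp only [eval_C, pow_zero, mul_one] at hpt ⊢
    refine ⟨C (Real.sqrt t : ℂ), by simp, fun z _ => ?_⟩
    rw [hpt, eval_C, Complex.norm_real, Real.norm_eq_abs, sq_abs, Real.sq_sqrt ht.le]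
  | succ d ih =>
    intro p hp hpos
    have hself : p = conjReflect (2 * (d + 1)) p := by
      refine eq_of_eval_eq_on_circle fun z hz => ?_
      obtain ⟨t, -, hpt⟩ := hpos z hz
      have hz' := pow_ne_zero (d + 1) (ne_zero_of_norm_one hz)
      rw [eval_conjReflect_of_norm_one hp hz, hpt, map_mul, Complex.conj_ofReal, map_pow,
        conj_eq_inv_of_norm_one hz, inv_pow, mul_comm 2, pow_mul, sq]
      generalize z ^ (d + 1) = y at hz'
      field_simp
    have hcoeff : p.coeff 0 = conj (p.coeff (2 * (d + 1))) := by
      conv_lhs => rw [hself]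
      rw [coeff_conjReflect p (Nat.zero_le _), Nat.sub_zero]
    -- `p` is self-reciprocal: either both its extreme coefficients vanish, or its roots come in
    -- pairs.
    by_cases htop : p.coeff (2 * (d + 1)) = 0
    · have h0 : p.coeff 0 = 0 := by rw [hcoeff, htop, map_zero]
      obtain ⟨q, rfl⟩ := X_dvd_iff.2 h0
      have hq : q.natDegree ≤ 2 * d := by
        refine natDegree_le_iff_coeff_eq_zero.2 fun k hk => ?_
        rw [← coeff_X_mul]
        rcases Nat.eq_or_lt_of_le (show 2 * (d + 1) ≤ k + 1 by omega) with h | h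
        · rw [← h, htop]
        · exact coeff_eq_zero_of_natDegree_lt (lt_of_le_of_lt hp h)
      obtain ⟨P, hP, hPe⟩ := ih q hq fun z hz => by
        obtain ⟨t, ht, hpt⟩ := hpos z hz
        refine ⟨t, ht, mul_left_cancel₀ (ne_zero_of_norm_one hz) ?_⟩
        rw [eval_mul, eval_X] at hpt
        rw [hpt]; ring
      refine ⟨P, hP.trans (Nat.le_succ d), fun z hz => ?_⟩
      rw [eval_mul, eval_X, hPe z hz]; ring
    · have hdeg : p.natDegree = 2 * (d + 1) := le_antisymm hp (le_natDegree_of_ne_zero htop)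
      obtain ⟨w, hw⟩ := IsAlgClosed.exists_root p
        (by rw [degree_eq_natDegree (by rintro rfl; simp at htop), hdeg]; norm_cast)
      have hw0 : w ≠ 0 := by
        rintro rfl
        rw [IsRoot, ← coeff_zero_eq_eval_zero, hcoeff] at hw
        exact htop (by simpa using hw)
      have hw1 : ‖w‖ ≠ 1 := by
        intro h
        obtain ⟨t, ht, hpt⟩ := hpos w h
        rw [hw] at hpt
        have := mul_ne_zero (Complex.ofReal_ne_zero.2 ht.ne') (pow_ne_zero (d + 1) hw0)
        exact this hpt.symm
      set u : ℂ := (conj w)⁻¹ with hu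
      have hcw : conj w ≠ 0 := by simpa using hw0
      have hu0 : u ≠ 0 := inv_ne_zero hcw
      have huw : u - w ≠ 0 := by
        intro h
        have h1 : w * conj w = 1 := by
          nth_rewrite 1 [← sub_eq_zero.1 h]
          rw [hu, inv_mul_cancel₀ hcw]
        rw [Complex.mul_conj, Complex.normSq_eq_norm_sq] at h1
        have h2 : ‖w‖ ^ 2 = 1 := by exact_mod_cast h1
        exact hw1 ((pow_eq_one_iff_of_nonneg (norm_nonneg w) two_ne_zero).1 h2)
      have hroot : p.eval u = 0 := by
        rw [hself, eval_conjReflect hp hu0, hu, map_inv₀, Complex.conj_conj, inv_inv,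
          hw.eq_zero, map_zero, mul_zero]
      obtain ⟨q, rfl⟩ := dvd_iff_isRoot.2 hw
      have hqu : q.IsRoot u := by
        rw [eval_mul, eval_sub, eval_X, eval_C] at hroot
        exact (mul_eq_zero.1 hroot).resolve_left huw
      obtain ⟨s, rfl⟩ := dvd_iff_isRoot.2 hqu
      have hs0 : s ≠ 0 := by rintro rfl; simp at htop
      have hsdeg : s.natDegree ≤ 2 * d := by
        rw [natDegree_mul (X_sub_C_ne_zero w) (mul_ne_zero (X_sub_C_ne_zero u) hs0),
          natDegree_mul (X_sub_C_ne_zero u) hs0, natDegree_X_sub_C, natDegree_X_sub_C] at hp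
        omega
      have hfac : ∀ z : ℂ, ‖z‖ = 1 →
          (z - w) * (z - u) = -u * z * ((‖z - w‖ ^ 2 : ℝ) : ℂ) := by
        intro z hz
        have hz0 := ne_zero_of_norm_one hz
        have hnorm : ((‖z - w‖ ^ 2 : ℝ) : ℂ) = (z - w) * conj (z - w) := by
          rw [Complex.mul_conj, Complex.normSq_eq_norm_sq]
        rw [hnorm, map_sub, conj_eq_inv_of_norm_one hz, hu]
        field_simp
        ring
      obtain ⟨P, hP, hPe⟩ := ih (C (-u) * s) ((natDegree_C_mul_le _ _).trans hsdeg) fun z hz => by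
        obtain ⟨t, ht, hpt⟩ := hpos z hz
        have hzw : z - w ≠ 0 := by
          intro h; rw [← sub_eq_zero.1 h] at hw1; exact hw1 hz
        have hzw' : 0 < ‖z - w‖ ^ 2 := by positivity
        refine ⟨t / ‖z - w‖ ^ 2, by positivity, ?_⟩
        simp only [eval_mul, eval_sub, eval_X, eval_C] at hpt ⊢
        rw [← mul_assoc, hfac z hz] at hpt
        have hne : ((‖z - w‖ ^ 2 : ℝ) : ℂ) ≠ 0 := Complex.ofReal_ne_zero.2 hzw'.ne'
        have hz0 := ne_zero_of_norm_one hz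
        rw [Complex.ofReal_div, div_mul_eq_mul_div, eq_div_iff hne]
        refine mul_left_cancel₀ hz0 ?_
        linear_combination hpt
      refine ⟨(X - C w) * P, ?_, fun z hz => ?_⟩
      · refine natDegree_mul_le.trans ?_
        rw [natDegree_X_sub_C]; omega
      · have h1 := hPe z hz
        simp only [eval_mul, eval_sub, eval_X, eval_C, norm_mul, mul_pow, Complex.ofReal_mul]
          at h1 ⊢
        rw [← mul_assoc, hfac z hz]
        linear_combination z * ((‖z - w‖ ^ 2 : ℝ) : ℂ) * h1

/-- The Fejér–Riesz theorem for a sum of squares, kept away from zero by a constant. -/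
theorem exists_norm_sq_eq_sum {ι : Type*} (t : Finset ι) (g : ι → ℂ[X]) {d : ℕ}
    (hg : ∀ i ∈ t, (g i).natDegree ≤ d) {c : ℝ} (hc : 0 < c) :
    ∃ P : ℂ[X], P.natDegree ≤ d ∧
      ∀ z : ℂ, ‖z‖ = 1 → ‖P.eval z‖ ^ 2 = ∑ i ∈ t, ‖(g i).eval z‖ ^ 2 + c := by
  have heval : ∀ z : ℂ, ‖z‖ = 1 →
      (∑ i ∈ t, g i * conjReflect d (g i) + C (c : ℂ) * X ^ d).eval z =
        ((∑ i ∈ t, ‖(g i).eval z‖ ^ 2 + c : ℝ) : ℂ) * z ^ d := by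
    intro z hz
    rw [eval_add, eval_finsetSum, eval_mul, eval_C, eval_pow, eval_X]
    push_cast
    rw [add_mul, Finset.sum_mul]
    congr 1
    refine Finset.sum_congr rfl fun i hi => ?_
    rw [eval_mul, eval_conjReflect_of_norm_one (hg i hi) hz, ← Complex.ofReal_pow,
      ← Complex.normSq_eq_norm_sq, ← Complex.mul_conj]
    ring
  obtain ⟨P, hP, hPe⟩ := exists_norm_sq_eq_of_pos d
    (∑ i ∈ t, g i * conjReflect d (g i) + C (c : ℂ) * X ^ d) (by
      refine (natDegree_add_le _ _).trans (max_le ?_ ?_)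
      · refine natDegree_sum_le_of_forall_le _ _ fun i hi => natDegree_mul_le.trans ?_
        have := hg i hi
        have := natDegree_conjReflect_le this
        omega
      · refine (natDegree_C_mul_X_pow_le _ _).trans (by omega))
    fun z hz => ⟨_, by positivity, heval z hz⟩
  refine ⟨P, hP, fun z hz => ?_⟩
  have h := (hPe z hz).symm.trans (heval z hz)
  exact_mod_cast mul_right_cancel₀ (pow_ne_zero d (ne_zero_of_norm_one hz)) h

/-! ### Generalised quantum signal processing -/

/-- For orthogonal vectors `u`, `v` in `ℂ²` there is a unit vector `(x, y)` parallel to `u` and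
orthogonal to `v`, even if `u` or `v` vanishes. -/
theorem exists_orthogonal_frame {u₁ u₂ v₁ v₂ : ℂ} (h : u₁ * conj v₁ + u₂ * conj v₂ = 0) :
    ∃ x y : ℂ, x * conj x + y * conj y = 1 ∧ x * u₂ = y * u₁ ∧
      conj x * v₁ + conj y * v₂ = 0 := by
  have key : ∀ s t : ℂ, ¬(s = 0 ∧ t = 0) → ∃ k : ℂ, conj k = k ∧
      (k * s) * conj (k * s) + (k * t) * conj (k * t) = 1 := by
    intro s t hst
    have hpos : 0 < ‖s‖ ^ 2 + ‖t‖ ^ 2 := by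
      rcases not_and_or.1 hst with h | h <;> positivity
    refine ⟨((Real.sqrt (‖s‖ ^ 2 + ‖t‖ ^ 2))⁻¹ : ℝ), Complex.conj_ofReal _, ?_⟩
    simp only [Complex.mul_conj, Complex.normSq_eq_norm_sq, norm_mul, Complex.norm_real, mul_pow,
      Real.norm_eq_abs, sq_abs, inv_pow, Real.sq_sqrt hpos.le]
    rw [← Complex.ofReal_add, ← mul_add, inv_mul_cancel₀ hpos.ne', Complex.ofReal_one]
  by_cases hu : u₁ = 0 ∧ u₂ = 0
  · by_cases hv : v₁ = 0 ∧ v₂ = 0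
    · exact ⟨1, 0, by simp, by simp [hu], by simp [hv]⟩
    · obtain ⟨k, hk, hn⟩ := key (-conj v₂) (conj v₁) (by simpa [and_comm] using hv)
      refine ⟨_, _, hn, by simp [hu], ?_⟩
      simp only [map_mul, map_neg, Complex.conj_conj]
      ring
  · obtain ⟨k, hk, hn⟩ := key u₁ u₂ hu
    refine ⟨_, _, hn, by ring, ?_⟩
    have h' := congrArg conj h
    simp only [map_add, map_mul, Complex.conj_conj, map_zero] at h' ⊢
    linear_combination conj k * h'

/-- The inductive step of generalised quantum signal processing: a pair of polynomials of degree
at most `d + 1` that is a unit vector at every point of the circle arises from such a pair of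
degree at most `d` by multiplying one component by `X` and rotating. The rotation is chosen so
that it cancels the leading coefficient of one component and the constant coefficient of the
other; this is possible because the vectors of leading and of constant coefficients are
orthogonal. -/
theorem exists_rotation_peeling {d : ℕ} {p q : ℂ[X]} (hp : p.natDegree ≤ d + 1)
    (hq : q.natDegree ≤ d + 1)
    (hpq : ∀ z : ℂ, ‖z‖ = 1 → ‖p.eval z‖ ^ 2 + ‖q.eval z‖ ^ 2 = 1) :
    ∃ (G : Matrix.unitaryGroup Bool ℂ) (p' q' : ℂ[X]), p'.natDegree ≤ d ∧ q'.natDegree ≤ d ∧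
      (∀ z : ℂ, ‖z‖ = 1 → ‖p'.eval z‖ ^ 2 + ‖q'.eval z‖ ^ 2 = 1) ∧
      p = C (G.1 false false) * p' + C (G.1 false true) * (X * q') ∧
      q = C (G.1 true false) * p' + C (G.1 true true) * (X * q') := by
  have hid : p * conjReflect (d + 1) p + q * conjReflect (d + 1) q = X ^ (d + 1) := by
    refine eq_of_eval_eq_on_circle fun z hz => ?_
    have h : ((‖p.eval z‖ ^ 2 + ‖q.eval z‖ ^ 2 : ℝ) : ℂ) = 1 := by rw [hpq z hz]; simp
    rw [Complex.ofReal_add, ← Complex.normSq_eq_norm_sq, ← Complex.normSq_eq_norm_sq,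
      ← Complex.mul_conj, ← Complex.mul_conj] at h
    rw [eval_add, eval_mul, eval_mul, eval_conjReflect_of_norm_one hp hz,
      eval_conjReflect_of_norm_one hq hz, eval_pow, eval_X]
    linear_combination z ^ (d + 1) * h
  have hcoeff : p.coeff (d + 1) * conj (p.coeff 0) + q.coeff (d + 1) * conj (q.coeff 0) = 0 := by
    have h := congrArg (fun f => coeff f ((d + 1) + (d + 1))) hid
    simp only [coeff_add] at h
    rw [coeff_mul_add_eq_of_natDegree_le hp (natDegree_conjReflect_le hp),
      coeff_mul_add_eq_of_natDegree_le hq (natDegree_conjReflect_le hq),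
      coeff_conjReflect p le_rfl, coeff_conjReflect q le_rfl, coeff_X_pow,
      if_neg (by omega), Nat.sub_self] at h
    exact h
  obtain ⟨x, y, hxy, h1, h2⟩ := exists_orthogonal_frame hcoeff
  let G : Matrix Bool Bool ℂ := Matrix.of fun i j =>
    if i then (if j then y else conj x) else (if j then x else -conj y)
  have hG : G ∈ Matrix.unitaryGroup Bool ℂ := by
    rw [Matrix.mem_unitaryGroup_iff]
    ext i j
    rcases i with _ | _ <;> rcases j with _ | _ <;>
      simp [G, Matrix.mul_apply, Matrix.star_apply] <;>
      first | linear_combination hxy | ring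
  have hX : X ∣ C (conj x) * p + C (conj y) * q := by
    rw [X_dvd_iff, coeff_add, coeff_C_mul, coeff_C_mul]; exact h2
  obtain ⟨q', hq'⟩ := hX
  have hC : C x * C (conj x) + C y * C (conj y) = (1 : ℂ[X]) := by
    rw [← C_mul, ← C_mul, ← C_add, hxy, C_1]
  refine ⟨⟨G, hG⟩, C (-y) * p + C x * q, q', ?_, ?_, ?_, ?_, ?_⟩
  · refine natDegree_le_iff_coeff_eq_zero.2 fun k hk => ?_
    rw [coeff_add, coeff_C_mul, coeff_C_mul]
    rcases Nat.eq_or_lt_of_le (show d + 1 ≤ k from hk) with h | h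
    · rw [← h]; linear_combination h1
    · rw [coeff_eq_zero_of_natDegree_lt (lt_of_le_of_lt hp h),
        coeff_eq_zero_of_natDegree_lt (lt_of_le_of_lt hq h)]
      ring
  · refine natDegree_le_iff_coeff_eq_zero.2 fun k hk => ?_
    rw [← coeff_X_mul, ← hq', coeff_add, coeff_C_mul, coeff_C_mul,
      coeff_eq_zero_of_natDegree_lt (by omega : p.natDegree < k + 1),
      coeff_eq_zero_of_natDegree_lt (by omega : q.natDegree < k + 1)]
    ring
  · intro z hz
    have hq'z : conj x * p.eval z + conj y * q.eval z = z * q'.eval z := by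
      have := congrArg (eval z) hq'
      simpa using this
    have hn : ‖q'.eval z‖ = ‖conj x * p.eval z + conj y * q.eval z‖ := by
      rw [hq'z, norm_mul, hz, one_mul]
    have h := congrArg (fun t : ℝ => (t : ℂ)) (hpq z hz)
    rw [hn]
    simp only [eval_add, eval_mul, eval_C, ← Complex.normSq_eq_norm_sq] at h ⊢
    apply Complex.ofReal_injective
    simp only [Complex.ofReal_add, ← Complex.mul_conj, Complex.ofReal_one, map_add, map_mul,
      map_neg, Complex.conj_conj] at h ⊢
    linear_combination h + (p.eval z * conj (p.eval z) + q.eval z * conj (q.eval z)) * hxy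
  · simp only [← hq', G, Matrix.of_apply, if_true, Bool.false_eq_true, if_false, C_neg]
    linear_combination -p * hC
  · simp only [← hq', G, Matrix.of_apply, if_true, Bool.false_eq_true, if_false, C_neg]
    linear_combination -q * hC

/-! ### A concentrated trigonometric kernel -/

/-- Parseval's identity on a grid of `N` equally spaced points of the unit circle. -/
theorem sum_norm_sq_eval_rotations {N : ℕ} {ω : ℂ} (hω : IsPrimitiveRoot ω N) {g : ℂ[X]}
    (hg : g.natDegree < N) {z : ℂ} (hz : ‖z‖ = 1) :
    ∑ j ∈ Finset.range N, ‖g.eval (z * ω ^ j)‖ ^ 2 = N * ∑ k ∈ Finset.range N, ‖g.coeff k‖ ^ 2 := by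
  have hN : N ≠ 0 := by omega
  have hω1 : ‖ω‖ = 1 := hω.norm'_eq_one hN
  have horth : ∀ k ∈ Finset.range N, ∀ l ∈ Finset.range N,
      ∑ j ∈ Finset.range N, (ω ^ j) ^ k * ((ω⁻¹) ^ j) ^ l = if k = l then (N : ℂ) else 0 := by
    intro k hk l hl
    have hω0 := ne_zero_of_norm_one hω1
    have hterm : ∀ j, (ω ^ j) ^ k * ((ω⁻¹) ^ j) ^ l = (ω ^ k * (ω⁻¹) ^ l) ^ j := by
      intro j; rw [mul_pow, ← pow_mul, ← pow_mul, ← pow_mul, ← pow_mul, mul_comm j, mul_comm j]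
    simp only [hterm]
    split_ifs with hkl
    · subst hkl
      simp [hω0]
    · have hne : ω ^ k * (ω⁻¹) ^ l ≠ 1 := by
        intro h
        apply hkl
        refine hω.pow_inj (Finset.mem_range.1 hk) (Finset.mem_range.1 hl) ?_
        rw [inv_pow, ← div_eq_mul_inv, div_eq_one_iff_eq (pow_ne_zero _ hω0)] at h
        exact h
      have hgeom := geom_sum_mul (ω ^ k * (ω⁻¹) ^ l) N
      have hpow : (ω ^ k * (ω⁻¹) ^ l) ^ N = 1 := by
        rw [mul_pow, ← pow_mul, ← pow_mul, mul_comm k, mul_comm l, pow_mul, pow_mul, inv_pow,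
          hω.pow_eq_one]
        simp
      rw [hpow, sub_self] at hgeom
      exact (mul_eq_zero.1 hgeom).resolve_right (sub_ne_zero.2 hne)
  apply Complex.ofReal_injective
  push_cast
  simp only [← Complex.conj_mul', eval_eq_sum_range' hg, map_sum, map_mul, map_pow,
    conj_eq_inv_of_norm_one hz, conj_eq_inv_of_norm_one hω1, Finset.sum_mul_sum]
  rw [Finset.sum_comm, Finset.mul_sum]
  refine Finset.sum_congr rfl fun l hl => ?_
  rw [Finset.sum_comm]
  have hinner : ∀ k ∈ Finset.range N,
      ∑ j ∈ Finset.range N, conj (g.coeff l) * (z⁻¹ * (ω⁻¹) ^ j) ^ l *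
        (g.coeff k * (z * ω ^ j) ^ k) =
      conj (g.coeff l) * g.coeff k * (z⁻¹) ^ l * z ^ k * if k = l then (N : ℂ) else 0 := by
    intro k hk
    rw [← horth k hk l hl, Finset.mul_sum]
    refine Finset.sum_congr rfl fun j _ => ?_
    rw [mul_pow, mul_pow]; ring
  rw [Finset.sum_congr rfl hinner, Finset.sum_eq_single_of_mem l hl
    (fun k _ hkl => by rw [if_neg hkl, mul_zero]), if_pos rfl]
  have hzz : (z⁻¹) ^ l * z ^ l = 1 := by
    rw [← mul_pow, inv_mul_cancel₀ (ne_zero_of_norm_one hz), one_pow]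
  linear_combination (conj (g.coeff l) * g.coeff l * N) * hzz

/-- The Dirichlet kernel `(1 + X + ⋯ + X ^ (L - 1)) / L`, normalised to be `1` at `1`. -/
noncomputable def dirichlet (L : ℕ) : ℂ[X] :=
  C (L : ℂ)⁻¹ * ∑ k ∈ Finset.range L, X ^ k

theorem natDegree_dirichlet_le (L : ℕ) : (dirichlet L).natDegree ≤ L - 1 := by
  refine (natDegree_C_mul_le _ _).trans (natDegree_sum_le_of_forall_le _ _ fun k hk => ?_)
  rw [natDegree_X_pow]
  have := Finset.mem_range.1 hk
  omega

theorem eval_one_dirichlet {L : ℕ} (hL : 0 < L) : (dirichlet L).eval 1 = 1 := by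
  have : (L : ℂ) ≠ 0 := by exact_mod_cast hL.ne'
  simp [dirichlet, eval_finsetSum, this]

theorem coeff_dirichlet {L k : ℕ} :
    (dirichlet L).coeff k = if k < L then (L : ℂ)⁻¹ else 0 := by
  simp [dirichlet, coeff_X_pow]

theorem norm_eval_dirichlet_mul_le {L : ℕ} (hL : 0 < L) (t : ℝ) :
    ‖(dirichlet L).eval (Complex.exp (t * Complex.I))‖ * (L * |Real.sin (t / 2)|) ≤ 1 := by
  set z := Complex.exp (t * Complex.I) with hz
  have hL' : (L : ℂ) ≠ 0 := by exact_mod_cast hL.ne'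
  have h1 : (dirichlet L).eval z * (L * (z - 1)) = z ^ L - 1 := by
    rw [← geom_sum_mul]
    simp only [dirichlet, eval_mul, eval_C, eval_finsetSum, eval_pow, eval_X]
    field_simp
  have h2 : ‖z - 1‖ = 2 * |Real.sin (t / 2)| := by
    rw [hz, mul_comm, Complex.norm_exp_I_mul_ofReal_sub_one]
    simp
  have h3 : ‖z ^ L - 1‖ ≤ 2 := by
    refine (norm_sub_le _ _).trans ?_
    rw [norm_pow, hz, Complex.norm_exp_ofReal_mul_I]; norm_num
  rw [← h1, norm_mul, norm_mul, h2, Complex.norm_natCast] at h3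
  linarith

/-- A power of the Dirichlet kernel has little of its mass at grid points where the Dirichlet
kernel is at most `M`. All but one of the factors are bounded by `M`, and Parseval's identity for
the last one cancels the dependence on `L`. -/
theorem sum_norm_sq_eval_pow_dirichlet_le {L s : ℕ} (hL : 0 < L) {ω : ℂ}
    (hω : IsPrimitiveRoot ω ((s + 1) * (L - 1) + 1)) {M : ℝ} {z : ℂ} (hz : ‖z‖ = 1)
    {J : Finset ℕ} (hJ : J ⊆ Finset.range ((s + 1) * (L - 1) + 1))
    (hM : ∀ j ∈ J, ‖(dirichlet L).eval (z * ω ^ j)‖ ≤ M) :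
    ∑ j ∈ J, ‖(dirichlet L ^ (s + 1)).eval (z * ω ^ j)‖ ^ 2 ≤
      (s + 1) * M ^ (2 * s) *
        ∑ j ∈ Finset.range ((s + 1) * (L - 1) + 1),
          ‖(dirichlet L ^ (s + 1)).eval (z * ω ^ j)‖ ^ 2 := by
  set N := (s + 1) * (L - 1) + 1 with hN
  have hN' : (N : ℝ) ≤ (s + 1) * L := by
    have : N ≤ (s + 1) * L := by
      obtain ⟨l, rfl⟩ := Nat.exists_eq_add_of_lt hL
      simp only [hN, Nat.zero_add, Nat.add_sub_cancel]
      nlinarith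
    exact_mod_cast this
  have hLpos : (0 : ℝ) < L := by exact_mod_cast hL
  have hdegD : (dirichlet L).natDegree < N := by
    refine lt_of_le_of_lt (natDegree_dirichlet_le L) ?_
    rw [hN, add_mul]; omega
  have hdegh : (dirichlet L ^ (s + 1)).natDegree < N := by
    refine Nat.lt_succ_of_le (natDegree_pow_le.trans ?_)
    exact Nat.mul_le_mul_left _ (natDegree_dirichlet_le L)
  have hupper : ∑ j ∈ J, ‖(dirichlet L ^ (s + 1)).eval (z * ω ^ j)‖ ^ 2 ≤
      M ^ (2 * s) * (s + 1) := by
    calc ∑ j ∈ J, ‖(dirichlet L ^ (s + 1)).eval (z * ω ^ j)‖ ^ 2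
        ≤ ∑ j ∈ J, M ^ (2 * s) * ‖(dirichlet L).eval (z * ω ^ j)‖ ^ 2 := by
          refine Finset.sum_le_sum fun j hj => ?_
          rw [eval_pow, norm_pow, ← pow_mul, show (s + 1) * 2 = 2 * s + 2 by ring, pow_add]
          gcongr
          exact hM j hj
      _ ≤ M ^ (2 * s) * ∑ j ∈ Finset.range N, ‖(dirichlet L).eval (z * ω ^ j)‖ ^ 2 := by
          rw [← Finset.mul_sum]
          have : 0 ≤ M ^ (2 * s) := by rw [pow_mul]; positivity
          gcongr
      _ ≤ M ^ (2 * s) * (s + 1) := by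
          have : 0 ≤ M ^ (2 * s) := by rw [pow_mul]; positivity
          gcongr
          rw [sum_norm_sq_eval_rotations hω hdegD hz]
          have hsum : ∑ k ∈ Finset.range N, ‖(dirichlet L).coeff k‖ ^ 2 ≤ (L : ℝ)⁻¹ := by
            calc ∑ k ∈ Finset.range N, ‖(dirichlet L).coeff k‖ ^ 2
                = ∑ k ∈ Finset.range N, if k < L then ((L : ℝ)⁻¹) ^ 2 else 0 := by
                  refine Finset.sum_congr rfl fun k _ => ?_
                  rw [coeff_dirichlet]; split_ifs <;> simp
              _ = ∑ k ∈ (Finset.range N).filter (· < L), ((L : ℝ)⁻¹) ^ 2 :=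
                  (Finset.sum_filter _ _).symm
              _ ≤ ∑ k ∈ Finset.range L, ((L : ℝ)⁻¹) ^ 2 := by
                  refine Finset.sum_le_sum_of_subset_of_nonneg ?_ fun _ _ _ => by positivity
                  intro k hk
                  exact Finset.mem_range.2 (Finset.mem_filter.1 hk).2
              _ = (L : ℝ)⁻¹ := by
                  rw [Finset.sum_const, Finset.card_range, nsmul_eq_mul]; field_simp
          calc (N : ℝ) * ∑ k ∈ Finset.range N, ‖(dirichlet L).coeff k‖ ^ 2
              ≤ ((s + 1) * L) * (L : ℝ)⁻¹ := by gcongr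
            _ = s + 1 := by field_simp
  have hlower : 1 ≤ ∑ j ∈ Finset.range N, ‖(dirichlet L ^ (s + 1)).eval (z * ω ^ j)‖ ^ 2 := by
    rw [sum_norm_sq_eval_rotations hω hdegh hz]
    have h1 : (dirichlet L ^ (s + 1)).eval 1 = 1 := by
      rw [eval_pow, eval_one_dirichlet hL, one_pow]
    rw [eval_eq_sum_range' hdegh] at h1
    simp only [one_pow, mul_one] at h1
    -- By Cauchy–Schwarz, as the coefficients sum to `1`.
    have h2 : 1 ≤ ∑ k ∈ Finset.range N, ‖(dirichlet L ^ (s + 1)).coeff k‖ := by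
      have := norm_sum_le (Finset.range N) fun k => (dirichlet L ^ (s + 1)).coeff k
      rwa [h1, norm_one] at this
    have h4 := sq_sum_le_card_mul_sum_sq (s := Finset.range N)
      (f := fun k => ‖(dirichlet L ^ (s + 1)).coeff k‖)
    rw [Finset.card_range] at h4
    nlinarith
  have h0 : 0 ≤ (s + 1) * M ^ (2 * s) := by rw [pow_mul]; positivity
  calc _ ≤ M ^ (2 * s) * (s + 1) := hupper
    _ = (s + 1) * M ^ (2 * s) * 1 := by ring
    _ ≤ _ := by gcongr

/-! ### Threshold polynomials -/

/-- For a set `J` of grid points, a polynomial `P` whose squared absolute value is, up to the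
small uniform shift `η`, the share of the mass of the kernel, centred at `z`, that lies on `J`,
and a polynomial `Q` for the remaining share. -/
theorem exists_polynomials_of_grid {L : ℕ} (s : ℕ) (hL : 0 < L) {ω : ℂ}
    (hω : IsPrimitiveRoot ω ((s + 1) * (L - 1) + 1)) {M η : ℝ} (hη : 0 < η) (hη1 : η < 1)
    {J : Finset ℕ} (hJ : J ⊆ Finset.range ((s + 1) * (L - 1) + 1)) :
    ∃ P Q : ℂ[X], P.natDegree ≤ (s + 1) * (L - 1) ∧ Q.natDegree ≤ (s + 1) * (L - 1) ∧
      (∀ z : ℂ, ‖z‖ = 1 → ‖P.eval z‖ ^ 2 + ‖Q.eval z‖ ^ 2 = 1) ∧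
      (∀ z : ℂ, ‖z‖ = 1 →
        (∀ j ∈ Finset.range ((s + 1) * (L - 1) + 1) \ J,
          ‖(dirichlet L).eval (z * ω ^ j)‖ ≤ M) →
        1 - ((s + 1) * M ^ (2 * s) + η / 2) ≤ ‖P.eval z‖ ^ 2) ∧
      (∀ z : ℂ, ‖z‖ = 1 → (∀ j ∈ J, ‖(dirichlet L).eval (z * ω ^ j)‖ ≤ M) →
        ‖P.eval z‖ ^ 2 ≤ (s + 1) * M ^ (2 * s) + η / 2) := by
  set d := (s + 1) * (L - 1) with hd
  set h := dirichlet L ^ (s + 1) with hh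
  have hdegh : h.natDegree ≤ d :=
    natDegree_pow_le.trans (Nat.mul_le_mul_left _ (natDegree_dirichlet_le L))
  set T : ℝ := (d + 1 : ℕ) * ∑ k ∈ Finset.range (d + 1), ‖h.coeff k‖ ^ 2 with hT
  have hTsum : ∀ z : ℂ, ‖z‖ = 1 →
      ∑ j ∈ Finset.range (d + 1), ‖h.eval (z * ω ^ j)‖ ^ 2 = T := fun z hz =>
    sum_norm_sq_eval_rotations hω (Nat.lt_succ_of_le hdegh) hz
  have hTpos : 0 < T := by
    rw [← hTsum 1 (by simp)]
    refine Finset.sum_pos' (fun _ _ => by positivity) ⟨0, by simp, ?_⟩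
    rw [hh, eval_pow]
    simp [eval_one_dirichlet hL]
  set g : ℕ → ℂ[X] := fun j => C (Real.sqrt ((1 - η) / T) : ℂ) * h.comp (C (ω ^ j) * X) with hg
  have hgdeg : ∀ j, (g j).natDegree ≤ d := fun j => by
    refine (natDegree_C_mul_le _ _).trans (natDegree_comp_le.trans ?_)
    calc h.natDegree * (C (ω ^ j) * X).natDegree ≤ d * 1 :=
          Nat.mul_le_mul hdegh ((natDegree_C_mul_le _ _).trans natDegree_X_le)
      _ = d := mul_one d
  have hgeval : ∀ j z, ‖(g j).eval z‖ ^ 2 = (1 - η) / T * ‖h.eval (z * ω ^ j)‖ ^ 2 := by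
    intro j z
    have : 0 ≤ (1 - η) / T := div_nonneg (by linarith) hTpos.le
    simp only [hg, eval_mul, eval_C, eval_comp, eval_X, norm_mul, mul_pow, Complex.norm_real,
      Real.norm_eq_abs, sq_abs, Real.sq_sqrt this, mul_comm (ω ^ j)]
  obtain ⟨P, hPd, hP⟩ := exists_norm_sq_eq_sum J g (fun i _ => hgdeg i) (half_pos hη)
  obtain ⟨Q, hQd, hQ⟩ := exists_norm_sq_eq_sum (Finset.range (d + 1) \ J) g (fun i _ => hgdeg i)
    (half_pos hη)
  simp only [hgeval, ← Finset.mul_sum] at hP hQ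
  have hPQ : ∀ z : ℂ, ‖z‖ = 1 → ‖P.eval z‖ ^ 2 + ‖Q.eval z‖ ^ 2 = 1 := by
    intro z hz
    have h1 := Finset.sum_sdiff (f := fun j => ‖h.eval (z * ω ^ j)‖ ^ 2) hJ
    rw [hTsum z hz] at h1
    rw [hP z hz, hQ z hz]
    have h2 : (1 - η) / T * T = 1 - η := by field_simp
    clear_value T
    linear_combination h2 + (1 - η) / T * h1
  have hbound : ∀ (K : Finset ℕ), K ⊆ Finset.range (d + 1) → ∀ z : ℂ, ‖z‖ = 1 →
      (∀ j ∈ K, ‖(dirichlet L).eval (z * ω ^ j)‖ ≤ M) →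
      (1 - η) / T * ∑ j ∈ K, ‖h.eval (z * ω ^ j)‖ ^ 2 + η / 2 ≤
        (s + 1) * M ^ (2 * s) + η / 2 := by
    intro K hK z hz hKM
    have h1 := sum_norm_sq_eval_pow_dirichlet_le hL hω hz hK hKM
    rw [← hd, ← hh, hTsum z hz] at h1
    have h0 : 0 ≤ (s + 1) * M ^ (2 * s) := by rw [pow_mul]; positivity
    have h2 : (1 - η) / T * ∑ j ∈ K, ‖h.eval (z * ω ^ j)‖ ^ 2 ≤
        (1 - η) / T * ((s + 1) * M ^ (2 * s) * T) :=
      mul_le_mul_of_nonneg_left h1 (div_nonneg (by linarith) hTpos.le)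
    have h3 : (1 - η) / T * ((s + 1) * M ^ (2 * s) * T) = (1 - η) * ((s + 1) * M ^ (2 * s)) := by
      field_simp
    nlinarith
  refine ⟨P, Q, hPd, hQd, hPQ, fun z hz hz' => ?_, fun z hz hz' => ?_⟩
  · have h1 := hbound _ Finset.sdiff_subset z hz hz'
    rw [← hQ z hz] at h1
    linarith [hPQ z hz]
  · rw [hP z hz]
    exact hbound J hJ z hz hz'

theorem sin_half_le_abs_sin_half {δ u : ℝ} (hδ : 0 ≤ δ) (h1 : δ ≤ |u|)
    (h2 : |u| ≤ 2 * Real.pi - δ) : Real.sin (δ / 2) ≤ |Real.sin (u / 2)| := by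
  have habs : |Real.sin (u / 2)| = |Real.sin (|u| / 2)| := by
    rcases abs_cases u with ⟨h, -⟩ | ⟨h, -⟩ <;> rw [h]
    rw [neg_div, Real.sin_neg, abs_neg]
  rw [habs]
  refine le_trans ?_ (le_abs_self _)
  rcases le_total |u| Real.pi with h | h
  · exact Real.sin_le_sin_of_le_of_le_pi_div_two (by linarith [Real.pi_pos]) (by linarith)
      (by linarith)
  · rw [← Real.sin_pi_sub (|u| / 2)]
    exact Real.sin_le_sin_of_le_of_le_pi_div_two (by linarith [Real.pi_pos]) (by linarith)
      (by linarith)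

/-- A pair of complementary polynomials, the first of which has absolute value nearly `1` at
angles up to `α` and nearly `0` at angles from `β` on. -/
theorem exists_polynomials_of_angles {L : ℕ} (s : ℕ) (hL : 0 < L) {α β δ M η : ℝ}
    (hη : 0 < η) (hη1 : η < 1) (hα : 0 ≤ α) (hβ : β ≤ Real.pi) (hδ : 0 ≤ δ)
    (hαβ : 2 * δ ≤ β - α) (hM : 0 < M) (hLM : 1 ≤ M * (L * Real.sin (δ / 2))) :
    ∃ P Q : ℂ[X], P.natDegree ≤ (s + 1) * (L - 1) ∧ Q.natDegree ≤ (s + 1) * (L - 1) ∧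
      (∀ z : ℂ, ‖z‖ = 1 → ‖P.eval z‖ ^ 2 + ‖Q.eval z‖ ^ 2 = 1) ∧
      (∀ φ : ℝ, |φ| ≤ α → 1 - ((s + 1) * M ^ (2 * s) + η / 2) ≤
        ‖P.eval (Complex.exp (φ * Complex.I))‖ ^ 2) ∧
      (∀ φ : ℝ, β ≤ |φ| → |φ| ≤ Real.pi →
        ‖P.eval (Complex.exp (φ * Complex.I))‖ ^ 2 ≤ (s + 1) * M ^ (2 * s) + η / 2) := by
  set N := (s + 1) * (L - 1) + 1 with hN
  have hN0 : (N : ℝ) ≠ 0 := by positivity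
  have hNpos : (0 : ℝ) < N := by positivity
  have hω := Complex.isPrimitiveRoot_exp N (Nat.succ_ne_zero _)
  set ω := Complex.exp (2 * Real.pi * Complex.I / N) with hωdef
  set θ : ℕ → ℝ := fun j => 2 * Real.pi * j / N with hθ
  -- The grid points whose angle is, modulo a full turn, within the midpoint of `α` and `β`.
  set J := (Finset.range N).filter fun j =>
    θ j ≤ (α + β) / 2 ∨ 2 * Real.pi - (α + β) / 2 ≤ θ j with hJ
  have hθ0 : ∀ j, 0 ≤ θ j := fun j => by have := Real.pi_pos; simp only [hθ]; positivity
  have hθ1 : ∀ j ∈ Finset.range N, θ j ≤ 2 * Real.pi := fun j hj => by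
    have : (j : ℝ) ≤ N := by exact_mod_cast (Finset.mem_range.1 hj).le
    simp only [hθ]
    rw [div_le_iff₀ hNpos]
    exact mul_le_mul_of_nonneg_left this (by linarith [Real.pi_pos])
  have hrot : ∀ (φ : ℝ) (j : ℕ), Complex.exp (φ * Complex.I) * ω ^ j =
      Complex.exp ((φ + θ j : ℝ) * Complex.I) := by
    intro φ j
    rw [hωdef, ← Complex.exp_nat_mul, ← Complex.exp_add]
    congr 1
    simp only [hθ]
    push_cast
    ring
  have hsmall : ∀ t : ℝ, Real.sin (δ / 2) ≤ |Real.sin (t / 2)| →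
      ‖(dirichlet L).eval (Complex.exp (t * Complex.I))‖ ≤ M := by
    intro t ht
    have hLpos : (0 : ℝ) < L := by exact_mod_cast hL
    have hs : 0 < L * Real.sin (δ / 2) := by
      by_contra hneg
      nlinarith
    have h1 := norm_eval_dirichlet_mul_le hL t
    have h2 : L * Real.sin (δ / 2) ≤ L * |Real.sin (t / 2)| :=
      mul_le_mul_of_nonneg_left ht hLpos.le
    refine le_of_mul_le_mul_right ?_ hs
    exact ((mul_le_mul_of_nonneg_left h2 (norm_nonneg _)).trans h1).trans hLM
  obtain ⟨P, Q, hPd, hQd, hPQ, hacc, hrej⟩ := exists_polynomials_of_grid (M := M) s hL hω hη hη1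
    (Finset.filter_subset _ _ : J ⊆ Finset.range N)
  refine ⟨P, Q, hPd, hQd, hPQ, fun φ hφ => hacc _ (Complex.norm_exp_ofReal_mul_I φ) ?_,
    fun φ hφ hφπ => hrej _ (Complex.norm_exp_ofReal_mul_I φ) ?_⟩
  · intro j hj
    rw [hrot]
    obtain ⟨hjN, hjJ⟩ := Finset.mem_sdiff.1 hj
    have hj' : ¬(θ j ≤ (α + β) / 2 ∨ 2 * Real.pi - (α + β) / 2 ≤ θ j) := fun h =>
      hjJ (Finset.mem_filter.2 ⟨hjN, h⟩)
    push Not at hj'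
    obtain ⟨h1, h2⟩ := abs_le.1 hφ
    refine hsmall _ (sin_half_le_abs_sin_half hδ ?_ ?_)
    · exact le_trans (by linarith) (le_abs_self _)
    · exact abs_le.2 ⟨by linarith, by linarith⟩
  · intro j hj
    rw [hrot]
    obtain ⟨hjN, hjJ⟩ := Finset.mem_filter.1 hj
    have h0 := hθ0 j
    have h1 := hθ1 j hjN
    have hφ' := abs_le.1 hφπ
    apply hsmall
    rcases hjJ with h | h
    · refine sin_half_le_abs_sin_half hδ ?_ (abs_le.2 ⟨by linarith, by linarith⟩)
      rcases le_abs'.1 hφ with h' | h'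
      · exact le_trans (by linarith) (neg_le_abs _)
      · exact le_trans (by linarith) (le_abs_self _)
    · -- Here the grid point is close to angle `0` from below, so a full turn is subtracted.
      have hshift : |Real.sin ((φ + θ j) / 2)| = |Real.sin ((φ + (θ j - 2 * Real.pi)) / 2)| := by
        rw [show (φ + θ j) / 2 = (φ + (θ j - 2 * Real.pi)) / 2 + Real.pi by ring,
          Real.sin_add_pi, abs_neg]
      rw [hshift]
      refine sin_half_le_abs_sin_half hδ ?_ (abs_le.2 ⟨by linarith, by linarith⟩)
      rcases le_abs'.1 hφ with h' | h'
      · exact le_trans (by linarith) (neg_le_abs _)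
      · exact le_trans (by linarith) (le_abs_self _)

theorem sub_le_arccos_sub_arccos {x y : ℝ} (hy : -1 ≤ y) (hyx : y ≤ x) (hx : x ≤ 1) :
    x - y ≤ Real.arccos y - Real.arccos x := by
  have h := Real.abs_cos_sub_cos_le (Real.arccos x) (Real.arccos y)
  rw [Real.cos_arccos (hy.trans hyx) hx, Real.cos_arccos hy (hyx.trans hx),
    abs_of_nonneg (by linarith), abs_sub_comm,
    abs_of_nonneg (by linarith [Real.arccos_le_arccos hyx])] at h
  exact h

/-- The weight outside the window for the kernel power `2 * r` and the bound `2 / 7` on the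
Dirichlet kernel. -/
theorem tail_le_exp_neg {r : ℕ} (hr : 1 ≤ r) :
    (((2 * r - 1 : ℕ) : ℝ) + 1) * (2 / 7 : ℝ) ^ (2 * (2 * r - 1)) ≤ Real.exp (-(r : ℝ)) / 2 := by
  obtain ⟨k, rfl⟩ := Nat.exists_eq_add_of_le hr
  have h1 : ((2 * (1 + k) - 1 : ℕ) : ℝ) + 1 = 2 * (1 + k) := by
    rw [show 2 * (1 + k) - 1 = 2 * k + 1 by omega]; push_cast; ring
  have h2 : (2 / 7 : ℝ) ^ (2 * (2 * (1 + k) - 1)) = (4 / 49) * (16 / 2401) ^ k := by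
    rw [show 2 * (2 * (1 + k) - 1) = 2 + 4 * k by omega, pow_add, pow_mul]; norm_num
  have h3 : (1 + k : ℝ) ≤ 2 ^ k := by
    have := one_add_mul_le_pow (show (-2 : ℝ) ≤ 1 by norm_num) k
    norm_num at this
    linarith
  have h4 : (16 / 49 : ℝ) ≤ Real.exp (-1) := by
    rw [Real.exp_neg, le_inv_comm₀ (by norm_num) (Real.exp_pos 1)]
    have := Real.exp_one_lt_d9
    norm_num at this ⊢
    linarith
  have h5 : Real.exp (-((1 + k : ℕ) : ℝ)) = Real.exp (-1) * Real.exp (-1) ^ k := by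
    rw [← Real.exp_nat_mul, ← Real.exp_add]; congr 1; push_cast; ring
  rw [h1, h2, h5]
  have h6 : (32 / 2401 : ℝ) ^ k ≤ Real.exp (-1) ^ k :=
    pow_le_pow_left₀ (by norm_num) (le_trans (by norm_num) h4) k
  calc 2 * (1 + k : ℝ) * (4 / 49 * (16 / 2401) ^ k)
      ≤ 2 * 2 ^ k * (4 / 49 * (16 / 2401) ^ k) := by gcongr
    _ = 16 / 49 / 2 * ((2 : ℝ) * (16 / 2401)) ^ k := by rw [mul_pow]; ring
    _ = 16 / 49 / 2 * (32 / 2401 : ℝ) ^ k := by norm_num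
    _ ≤ Real.exp (-1) / 2 * Real.exp (-1) ^ k := by gcongr
    _ = Real.exp (-1) * Real.exp (-1) ^ k / 2 := by ring

/-- The polynomials that drive the amplification, in terms of the acceptance probability
`(1 + cos φ) / 2` that belongs to the angle `φ`. In terms of the half-angle
`arccos (√p)` of a probability `p`, the thresholds `a` and `b` are at least `√a - √b` apart. -/
theorem exists_amplifying_polynomials {a b : ℝ} (hb : 0 ≤ b) (hba : b < a) (ha : a ≤ 1) (r : ℕ) :
    ∃ (d : ℕ) (P Q : ℂ[X]), P.natDegree ≤ d ∧ Q.natDegree ≤ d ∧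
      2 * (d : ℝ) ≤ 10 * Real.pi * (Real.sqrt a + Real.sqrt b) * r / (a - b) ∧
      (∀ z : ℂ, ‖z‖ = 1 → ‖P.eval z‖ ^ 2 + ‖Q.eval z‖ ^ 2 = 1) ∧
      (∀ φ : ℝ, |φ| ≤ Real.pi → a ≤ (1 + Real.cos φ) / 2 →
        1 - Real.exp (-(r : ℝ)) ≤ ‖P.eval (Complex.exp (φ * Complex.I))‖ ^ 2) ∧
      (∀ φ : ℝ, |φ| ≤ Real.pi → (1 + Real.cos φ) / 2 ≤ b →
        ‖P.eval (Complex.exp (φ * Complex.I))‖ ^ 2 ≤ Real.exp (-(r : ℝ))) := by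
  rcases Nat.eq_zero_or_pos r with rfl | hr
  · -- For `r = 0` no evaluation is allowed, and never accepting is good enough.
    exact ⟨0, 0, 1, by simp, by simp, by simp, by simp, by simp, by simp⟩
  have ha0 : 0 ≤ a := hb.trans hba.le
  have hsb : 0 ≤ Real.sqrt b := Real.sqrt_nonneg b
  have hsba : Real.sqrt b < Real.sqrt a := Real.sqrt_lt_sqrt hb hba
  have hsa : Real.sqrt a ≤ 1 := Real.sqrt_le_one.2 ha
  set δ := Real.sqrt a - Real.sqrt b with hδ
  have hδ0 : 0 < δ := sub_pos.2 hsba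
  have hδ1 : δ ≤ 1 := by linarith
  have hπ := Real.pi_pos
  have hδab : δ * (Real.sqrt a + Real.sqrt b) = a - b := by
    rw [hδ]
    linear_combination Real.sq_sqrt ha0 - Real.sq_sqrt hb
  -- `2 * r` factors of degree `l` have total degree at most `5 * π * r / δ`, and each use of the
  -- walk operator costs two evaluations.
  set l := ⌊5 * Real.pi / (2 * δ)⌋₊ with hl
  have hl1 : (l : ℝ) ≤ 5 * Real.pi / (2 * δ) := Nat.floor_le (by positivity)
  have hl2 : 5 * Real.pi / (2 * δ) ≤ l + 1 := (Nat.lt_floor_add_one _).le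
  have hsin : 1 ≤ 2 / 7 * (((l + 1 : ℕ) : ℝ) * Real.sin (δ / 2)) := by
    have h1 := Real.sin_gt_sub_cube (half_pos hδ0)
    have h2 : 23 / 48 * δ ≤ Real.sin (δ / 2) := by nlinarith [mul_pos hδ0 hδ0]
    have h3 : 5 * Real.pi ≤ (l + 1) * (2 * δ) := (div_le_iff₀ (by positivity)).1 hl2
    have h4 := Real.pi_gt_three
    push_cast
    have h5 : ((l : ℝ) + 1) * (23 / 48 * δ) ≤ (l + 1) * Real.sin (δ / 2) := by gcongr
    nlinarith
  obtain ⟨P, Q, hP, hQ, hPQ, hacc, hrej⟩ := exists_polynomials_of_angles (L := l + 1)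
    (α := 2 * Real.arccos (Real.sqrt a)) (β := 2 * Real.arccos (Real.sqrt b)) (δ := δ)
    (M := 2 / 7) (η := Real.exp (-(r : ℝ))) (2 * r - 1) (Nat.succ_pos l) (Real.exp_pos _)
    (Real.exp_lt_one_iff.2 (neg_lt_zero.2 (by exact_mod_cast hr)))
    (by linarith [Real.arccos_nonneg (Real.sqrt a)])
    (by linarith [Real.arccos_le_pi_div_two.2 hsb]) hδ0.le
    (by linarith [sub_le_arccos_sub_arccos (by linarith) hsba.le hsa]) (by norm_num) hsin
  have htail := tail_le_exp_neg hr
  have hhalf : ∀ φ : ℝ, |φ| ≤ Real.pi →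
      Real.cos (|φ| / 2) ^ 2 = (1 + Real.cos φ) / 2 ∧ 0 ≤ Real.cos (|φ| / 2) ∧
      Real.arccos (Real.cos (|φ| / 2)) = |φ| / 2 := by
    intro φ hφ
    have h0 := abs_nonneg φ
    refine ⟨?_, Real.cos_nonneg_of_mem_Icc ⟨by linarith, by linarith⟩,
      Real.arccos_cos (by linarith) (by linarith)⟩
    rw [Real.cos_sq, mul_div_cancel₀ _ two_ne_zero, Real.cos_abs]
    ring
  refine ⟨(2 * r - 1 + 1) * (l + 1 - 1), P, Q, hP, hQ, ?_, hPQ, fun φ hφ h => ?_,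
    fun φ hφ h => ?_⟩
  · rw [Nat.sub_add_cancel (by omega), Nat.add_sub_cancel, ← hδab]
    push_cast
    have hne : Real.sqrt a + Real.sqrt b ≠ 0 := by linarith
    calc 2 * (2 * (r : ℝ) * l) ≤ 2 * (2 * (r : ℝ) * (5 * Real.pi / (2 * δ))) := by gcongr
      _ = 10 * Real.pi * (Real.sqrt a + Real.sqrt b) * r /
          (δ * (Real.sqrt a + Real.sqrt b)) := by field_simp; ring
  · obtain ⟨h1, h2, h3⟩ := hhalf φ hφ
    refine le_trans ?_ (hacc φ ?_)
    · linarith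
    · have : Real.sqrt a ≤ Real.cos (|φ| / 2) := by
        rw [← Real.sqrt_sq h2, h1]; exact Real.sqrt_le_sqrt h
      have := Real.arccos_le_arccos this
      rw [h3] at this
      linarith
  · obtain ⟨h1, h2, h3⟩ := hhalf φ hφ
    refine (hrej φ ?_ hφ).trans (by linarith)
    have : Real.cos (|φ| / 2) ≤ Real.sqrt b := by
      rw [← Real.sqrt_sq h2, h1]; exact Real.sqrt_le_sqrt h
    have := Real.arccos_le_arccos this
    rw [h3] at this
    linarith

/-! ### The product of two reflections -/

section Walk

variable {K ν : Type*} [Fintype K] [DecidableEq K] [Fintype ν] [DecidableEq ν]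

/-- The Chebyshev recurrence along the orbit of `Z ψ` determines the components of its points in
the range of `Z`. -/
theorem conjTranspose_mulVec_pow_mulVec {Z : Matrix K ν ℂ} (hZ : Zᴴ * Z = 1) {U : Matrix K K ℂ}
    {ψ : ν → ℂ} {φ : ℝ} (h1 : Zᴴ *ᵥ (U *ᵥ (Z *ᵥ ψ)) = (Real.cos φ : ℂ) • ψ)
    (h2 : U *ᵥ (U *ᵥ (Z *ᵥ ψ)) = (2 * Real.cos φ : ℂ) • (U *ᵥ (Z *ᵥ ψ)) - Z *ᵥ ψ) (j : ℕ) :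
    Zᴴ *ᵥ (U ^ j *ᵥ (Z *ᵥ ψ)) = (Real.cos (j * φ) : ℂ) • ψ := by
  induction j using Nat.twoStepInduction with
  | zero => simp [mulVec_mulVec, hZ]
  | one => rw [pow_one, h1, Nat.cast_one, one_mul]
  | more j ih0 ih1 =>
    have hrec : U ^ (j + 2) *ᵥ (Z *ᵥ ψ) =
        (2 * Real.cos φ : ℂ) • (U ^ (j + 1) *ᵥ (Z *ᵥ ψ)) - U ^ j *ᵥ (Z *ᵥ ψ) := by
      rw [pow_add, ← mulVec_mulVec, sq, ← mulVec_mulVec, h2, mulVec_sub, mulVec_smul, pow_succ,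
        ← mulVec_mulVec]
    have hcos : Real.cos ((j + 2 : ℕ) * φ) =
        2 * Real.cos φ * Real.cos ((j + 1 : ℕ) * φ) - Real.cos (j * φ) := by
      have e1 : ((j + 2 : ℕ) : ℝ) * φ = (j + 1 : ℕ) * φ + φ := by push_cast; ring
      have e2 : (j : ℝ) * φ = (j + 1 : ℕ) * φ - φ := by push_cast; ring
      rw [e1, e2, Real.cos_add, Real.cos_sub]; ring
    rw [hrec, mulVec_sub, mulVec_smul, ih0, ih1, hcos, smul_smul, ← sub_smul]
    push_cast
    rfl

theorem sum_sum_cos_eq_norm_sq_add (P : ℂ[X]) (φ : ℝ) :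
    ∑ k ∈ Finset.range (P.natDegree + 1), ∑ l ∈ Finset.range (P.natDegree + 1),
      conj (P.coeff k) * P.coeff l * (Real.cos (((l : ℝ) - k) * φ) : ℂ) =
    (((‖P.eval (Complex.exp (φ * Complex.I))‖ ^ 2 +
      ‖P.eval (Complex.exp ((-φ : ℝ) * Complex.I))‖ ^ 2) / 2 : ℝ) : ℂ) := by
  have hn : ∀ t : ℝ, ((‖P.eval (Complex.exp (t * Complex.I))‖ ^ 2 : ℝ) : ℂ) =
      ∑ k ∈ Finset.range (P.natDegree + 1), ∑ l ∈ Finset.range (P.natDegree + 1),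
        conj (P.coeff k) * P.coeff l * Complex.exp (((l : ℝ) - k : ℝ) * t * Complex.I) := by
    intro t
    rw [Complex.ofReal_pow, ← Complex.conj_mul', eval_eq_sum_range, map_sum, Finset.sum_mul_sum]
    refine Finset.sum_congr rfl fun k _ => Finset.sum_congr rfl fun l _ => ?_
    rw [map_mul, map_pow, ← Complex.exp_conj, ← Complex.exp_nat_mul, ← Complex.exp_nat_mul,
      mul_mul_mul_comm, ← Complex.exp_add]
    congr 2
    simp only [map_mul, Complex.conj_ofReal, Complex.conj_I]
    push_cast
    ring
  rw [Complex.ofReal_div, Complex.ofReal_add, hn, hn, ← Finset.sum_add_distrib, Finset.sum_div]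
  refine Finset.sum_congr rfl fun k _ => ?_
  rw [← Finset.sum_add_distrib, Finset.sum_div]
  refine Finset.sum_congr rfl fun l _ => ?_
  rw [Complex.ofReal_cos, Complex.cos]
  push_cast
  rw [show ((l : ℂ) - k) * -(φ : ℂ) * Complex.I = -(((l : ℂ) - k) * φ) * Complex.I by ring]
  ring

/-- The product of a reflection `R` with the reflection `1 - 2 * Z * Zᴴ`, which negates the range of
the isometry `Z` and fixes its orthogonal complement. With this choice of sign, the eigenvalue
that belongs to acceptance probability `1` is `1`. -/
noncomputable def walk (R : Matrix K K ℂ) (Z : Matrix K ν ℂ) : Matrix K K ℂ :=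
  R * (1 - (2 : ℂ) • (Z * Zᴴ))

/-- Let `Z` be an isometry, `R` a reflection, and `W = walk R Z`. Every eigenvector `ψ` of the compression `1 - 2 * A` of `R` is also an
eigenvector of the compression of `P(W)ᴴ * P(W)`, for any polynomial `P`. Indeed `Z ψ` satisfies
the Chebyshev recurrence `W² Z ψ = 2 cos φ W Z ψ - Z ψ`, so all its correlations
`Zᴴ W ^ j Z ψ` are `cos (j φ) ψ`. -/
theorem compression_aeval_walk {Z : Matrix K ν ℂ} (hZ : Zᴴ * Z = 1) {R : Matrix K K ℂ}
    (hR : Rᴴ = R) (hRR : R * R = 1) {A : Matrix ν ν ℂ} (hA : Zᴴ * R * Z = 1 - (2 : ℂ) • A)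
    {ψ : ν → ℂ} {φ : ℝ} (hψ : A *ᵥ ψ = (((1 + Real.cos φ) / 2 : ℝ) : ℂ) • ψ) (P : ℂ[X]) :
    ((aeval (walk R Z) P * Z)ᴴ * (aeval (walk R Z) P * Z)) *ᵥ ψ =
      (((‖P.eval (Complex.exp (φ * Complex.I))‖ ^ 2 +
        ‖P.eval (Complex.exp ((-φ : ℝ) * Complex.I))‖ ^ 2) / 2 : ℝ) : ℂ) • ψ := by
  rw [walk]
  set S : Matrix K K ℂ := 1 - (2 : ℂ) • (Z * Zᴴ) with hS
  have hSZ : S * Z = -Z := by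
    rw [hS, Matrix.sub_mul, Matrix.one_mul, Matrix.smul_mul, Matrix.mul_assoc, hZ, Matrix.mul_one,
      two_smul]
    abel
  have hSH : Sᴴ = S := by
    rw [hS, conjTranspose_sub, conjTranspose_one, conjTranspose_smul, conjTranspose_mul,
      conjTranspose_conjTranspose]
    simp
  have hZS : Zᴴ * S = -Zᴴ := by
    have := congrArg conjTranspose hSZ
    rwa [conjTranspose_mul, hSH, conjTranspose_neg] at this
  have hSS : S * S = 1 := by
    nth_rewrite 2 [hS]
    rw [Matrix.mul_sub, Matrix.mul_one, Matrix.mul_smul, ← Matrix.mul_assoc, hSZ, Matrix.neg_mul, hS]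
    simp
  set W := R * S with hW
  have hWH : Wᴴ = S * R := by rw [hW, conjTranspose_mul, hR, hSH]
  have hWHW : Wᴴ * W = 1 := by
    rw [hWH, hW, Matrix.mul_assoc, ← Matrix.mul_assoc R, hRR, Matrix.one_mul, hSS]
  have hc : ∀ χ : ν → ℂ, Zᴴ *ᵥ (R *ᵥ (Z *ᵥ χ)) = χ - (2 : ℂ) • A *ᵥ χ := by
    intro χ
    rw [mulVec_mulVec, mulVec_mulVec, hA, Matrix.sub_mulVec, one_mulVec,
      smul_mulVec]
  have hc' : Zᴴ *ᵥ (R *ᵥ (Z *ᵥ ψ)) = -(Real.cos φ : ℂ) • ψ := by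
    rw [hc, hψ, smul_smul]
    nth_rewrite 1 [← one_smul ℂ ψ]
    rw [← sub_smul]
    congr 1
    push_cast; ring
  have hWZ : W *ᵥ (Z *ᵥ ψ) = -(R *ᵥ (Z *ᵥ ψ)) := by
    rw [hW, mulVec_mulVec, Matrix.mul_assoc, hSZ, Matrix.mul_neg, neg_mulVec, ← mulVec_mulVec]
  have hSR : S *ᵥ (R *ᵥ (Z *ᵥ ψ)) = R *ᵥ (Z *ᵥ ψ) + (2 * Real.cos φ : ℂ) • Z *ᵥ ψ := by
    rw [hS, sub_mulVec, one_mulVec, smul_mulVec, ← mulVec_mulVec, hc', mulVec_smul,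
      smul_smul, sub_eq_add_neg, ← neg_smul]
    congr 2
    push_cast; ring
  have hWW : W *ᵥ (W *ᵥ (Z *ᵥ ψ)) =
      (2 * Real.cos φ : ℂ) • (W *ᵥ (Z *ᵥ ψ)) - Z *ᵥ ψ := by
    rw [hWZ, mulVec_neg, hW, ← mulVec_mulVec, hSR, mulVec_add, mulVec_mulVec, hRR, one_mulVec,
      mulVec_smul, smul_neg]
    abel
  have hHcancel : ∀ χ : K → ℂ, Wᴴ *ᵥ (W *ᵥ χ) = χ := fun χ => by
    rw [mulVec_mulVec, hWHW, one_mulVec]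
  -- Both `W` and its inverse `Wᴴ` satisfy the recurrence, so all integer powers are covered.
  have hpos := conjTranspose_mulVec_pow_mulVec hZ (U := W) (φ := φ)
    (by rw [hWZ, mulVec_neg, hc', neg_smul, neg_neg]) hWW
  have hneg := conjTranspose_mulVec_pow_mulVec hZ (U := Wᴴ) (φ := φ) (ψ := ψ)
    (by rw [hWH, ← mulVec_mulVec, mulVec_mulVec, hZS, neg_mulVec, hc', neg_smul, neg_neg])
    (by
      have h := congrArg (fun χ => Wᴴ *ᵥ (Wᴴ *ᵥ χ)) hWW
      simp only [hHcancel, mulVec_sub, mulVec_smul] at h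
      rw [eq_sub_iff_add_eq] at h ⊢
      rw [add_comm, h])
  have hcorr : ∀ k l : ℕ, Zᴴ *ᵥ ((Wᴴ) ^ k *ᵥ (W ^ l *ᵥ (Z *ᵥ ψ))) =
      (Real.cos (((l : ℝ) - k) * φ) : ℂ) • ψ := by
    intro k
    induction k with
    | zero => intro l; simpa using hpos l
    | succ k ih =>
      intro l
      cases l with
      | zero =>
        have := hneg (k + 1)
        rw [pow_zero, one_mulVec, this, ← Real.cos_neg]
        congr 3
        push_cast; ring
      | succ l =>
        rw [pow_succ, pow_succ', ← mulVec_mulVec, ← mulVec_mulVec, hHcancel, ih l]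
        congr 3
        push_cast; ring
  have hstar : (aeval W P)ᴴ =
      ∑ k ∈ Finset.range (P.natDegree + 1), conj (P.coeff k) • (Wᴴ) ^ k := by
    rw [aeval_eq_sum_range, conjTranspose_sum]
    refine Finset.sum_congr rfl fun k _ => ?_
    rw [conjTranspose_smul, conjTranspose_pow]
    rfl
  rw [← sum_sum_cos_eq_norm_sq_add, conjTranspose_mul, ← mulVec_mulVec, ← mulVec_mulVec,
    ← mulVec_mulVec, hstar]
  nth_rewrite 1 [aeval_eq_sum_range]
  rw [Finset.sum_smul, sum_mulVec, mulVec_sum]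
  refine Finset.sum_congr rfl fun k _ => ?_
  rw [Finset.sum_smul, sum_mulVec, mulVec_sum, mulVec_sum]
  refine Finset.sum_congr rfl fun l _ => ?_
  rw [smul_mulVec, smul_mulVec, mulVec_smul, mulVec_smul, mulVec_smul, hcorr, smul_smul, smul_smul]

end Walk

theorem sum_norm_sq_mulVec_of_eigenbasis {K ν : Type*} [Fintype K] [Fintype ν] (T : Matrix K ν ℂ)
    (B : OrthonormalBasis ν ℂ (EuclideanSpace ℂ ν)) (g : ν → ℝ)
    (hg : ∀ i, (Tᴴ * T) *ᵥ (B i).ofLp = ((g i : ℝ) : ℂ) • (B i).ofLp)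
    (ψ : EuclideanSpace ℂ ν) :
    ∑ x, ‖(T *ᵥ ψ.ofLp) x‖ ^ 2 = ∑ i, g i * ‖inner ℂ (B i) ψ‖ ^ 2 := by
  have h1 : ((∑ x, ‖(T *ᵥ ψ.ofLp) x‖ ^ 2 : ℝ) : ℂ) = star ψ.ofLp ⬝ᵥ ((Tᴴ * T) *ᵥ ψ.ofLp) := by
    rw [← mulVec_mulVec, dotProduct_mulVec, ← star_mulVec, dotProduct]
    push_cast
    refine Finset.sum_congr rfl fun x _ => ?_
    rw [← Complex.conj_mul']
    rfl
  have h2 : (Tᴴ * T) *ᵥ ψ.ofLp =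
      ∑ i, (inner ℂ (B i) ψ * (g i : ℂ)) • (B i).ofLp := by
    conv_lhs => rw [← B.sum_repr' ψ]
    rw [WithLp.ofLp_sum, mulVec_sum]
    refine Finset.sum_congr rfl fun i _ => ?_
    rw [WithLp.ofLp_smul, mulVec_smul, hg, smul_smul]
  apply Complex.ofReal_injective
  rw [h1, h2, dotProduct_sum]
  push_cast
  refine Finset.sum_congr rfl fun i _ => ?_
  rw [dotProduct_smul, smul_eq_mul]
  have h3 : star ψ.ofLp ⬝ᵥ (B i).ofLp = conj (inner ℂ (B i) ψ) := by
    rw [inner_conj_symm, EuclideanSpace.inner_eq_star_dotProduct, dotProduct_comm]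
  rw [h3, ← Complex.conj_mul']
  ring

/-! ### Spectral analysis of a verifier -/

section VerifierWalk

variable {n m : ℕ}

/-- The isometry that adjoins ancillae in the state `|0…0⟩`. -/
def adjoinAncillae (n m : ℕ) : Matrix (Fin n ⊕ Fin m → Bool) (Fin n → Bool) ℂ :=
  fun x y => if (∀ j, x (Sum.inr j) = false) ∧ y = (fun i => x (Sum.inl i)) then 1 else 0

theorem adjoinAncillae_mulVec (ψ : EuclideanSpace ℂ (Fin n → Bool)) :
    adjoinAncillae n m *ᵥ ψ.ofLp = withAncillae m ψ := by
  ext x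
  by_cases h : ∀ j, x (Sum.inr j) = false <;>
    simp [mulVec, dotProduct, adjoinAncillae, withAncillae, h]

theorem conjTranspose_adjoinAncillae_mul_self :
    (adjoinAncillae n m)ᴴ * adjoinAncillae n m = 1 := by
  ext y y'
  rw [Matrix.mul_apply, Finset.sum_eq_single (Sum.elim y fun _ => false)]
  · rw [Matrix.one_apply]
    simp [adjoinAncillae, conjTranspose_apply, eq_comm]
  · intro x _ hx
    have : ¬((∀ j, x (Sum.inr j) = false) ∧ y = (fun i => x (Sum.inl i))) := by
      rintro ⟨h1, rfl⟩
      apply hx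
      ext (i | j)
      · rfl
      · exact h1 j
    simp [adjoinAncillae, conjTranspose_apply, this]
  · simp

theorem reflection_adjoinAncillae :
    1 - (2 : ℂ) • (adjoinAncillae n m * (adjoinAncillae n m)ᴴ) =
      diagonal fun x => if ∀ j, x (Sum.inr j) = false then -1 else 1 := by
  ext x x'
  have hsum : (adjoinAncillae n m * (adjoinAncillae n m)ᴴ) x x' =
      if x = x' ∧ ∀ j, x (Sum.inr j) = false then 1 else 0 := by
    rw [Matrix.mul_apply]
    by_cases h : ∀ j, x (Sum.inr j) = false
    · rw [Finset.sum_eq_single fun i => x (Sum.inl i)]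
      · by_cases hx : x = x'
        · subst hx
          simp [adjoinAncillae, conjTranspose_apply, h]
        · have : ¬((∀ j, x' (Sum.inr j) = false) ∧
              (fun i => x (Sum.inl i)) = (fun i => x' (Sum.inl i))) := by
            rintro ⟨h1, h2⟩
            apply hx
            ext (i | j)
            · exact congrFun h2 i
            · rw [h, h1]
          simp [adjoinAncillae, conjTranspose_apply, hx, this]
      · intro y _ hy
        simp [adjoinAncillae, hy]
      · simp
    · simp [adjoinAncillae, h]
  rw [Matrix.sub_apply, Matrix.smul_apply, hsum]
  by_cases hx : x = x'
  · subst hx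
    by_cases h : ∀ j, x (Sum.inr j) = false
    · simp only [one_apply_eq, diagonal_apply_eq, h, implies_true, and_self, if_true]
      norm_num
    · simp [h]
  · simp [hx]

/-- The reflection `Vᴴ (1 - 2 Π) V`, where `Π` projects onto the accepting states. -/
def acceptReflection {S : Type} [Fintype S] [DecidableEq S]
    (V : Matrix.unitaryGroup (S → Bool) ℂ) (out : S) : Matrix (S → Bool) (S → Bool) ℂ :=
  star V.1 * diagonal (fun x => if x out = true then -1 else 1) * V.1

/-- The walk operator of a verifier. -/
noncomputable def verifierWalk (V : Matrix.unitaryGroup (Fin n ⊕ Fin m → Bool) ℂ)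
    (out : Fin n ⊕ Fin m) : Matrix (Fin n ⊕ Fin m → Bool) (Fin n ⊕ Fin m → Bool) ℂ :=
  walk (acceptReflection V out) (adjoinAncillae n m)

theorem conjTranspose_acceptReflection {S : Type} [Fintype S] [DecidableEq S]
    (V : Matrix.unitaryGroup (S → Bool) ℂ) (out : S) :
    (acceptReflection V out)ᴴ = acceptReflection V out := by
  rw [acceptReflection, conjTranspose_mul, conjTranspose_mul, diagonal_conjTranspose,
    star_eq_conjTranspose, conjTranspose_conjTranspose, Matrix.mul_assoc]
  congr 3
  ext x
  by_cases h : x out = true <;> simp [h]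

theorem acceptReflection_mul_self {S : Type} [Fintype S] [DecidableEq S]
    (V : Matrix.unitaryGroup (S → Bool) ℂ) (out : S) :
    acceptReflection V out * acceptReflection V out = 1 := by
  have hV : V.1 * star V.1 = 1 := Matrix.mem_unitaryGroup_iff.1 V.2
  have hV' : star V.1 * V.1 = 1 := Matrix.mem_unitaryGroup_iff'.1 V.2
  have hD : (diagonal (fun x : S → Bool => if x out = true then (-1 : ℂ) else 1)) *
      diagonal (fun x => if x out = true then -1 else 1) = 1 := by
    rw [diagonal_mul_diagonal, ← diagonal_one]
    congr 1
    ext x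
    by_cases h : x out = true <;> simp [h]
  rw [acceptReflection, Matrix.mul_assoc, Matrix.mul_assoc, Matrix.mul_assoc,
    ← Matrix.mul_assoc V.1, hV, Matrix.one_mul, ← Matrix.mul_assoc (diagonal _), hD,
    Matrix.one_mul, hV']

/-- The acceptance amplitudes of a verifier, as a map from witness states. -/
def acceptMap (V : Matrix.unitaryGroup (Fin n ⊕ Fin m → Bool) ℂ) (out : Fin n ⊕ Fin m) :
    Matrix (Fin n ⊕ Fin m → Bool) (Fin n → Bool) ℂ :=
  diagonal (fun x => if x out = true then 1 else 0) * V.1 * adjoinAncillae n m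

theorem acceptProb_eq (V : Matrix.unitaryGroup (Fin n ⊕ Fin m → Bool) ℂ) (out : Fin n ⊕ Fin m)
    (ψ : EuclideanSpace ℂ (Fin n → Bool)) :
    (Verifier.mk V out).acceptProb ψ = ∑ x, ‖(acceptMap V out *ᵥ ψ.ofLp) x‖ ^ 2 := by
  rw [Verifier.acceptProb]
  refine Finset.sum_congr rfl fun x _ => ?_
  rw [acceptMap, ← mulVec_mulVec, ← mulVec_mulVec, adjoinAncillae_mulVec, mulVec_diagonal]
  by_cases h : x out = true <;> simp [h]

theorem compression_acceptReflection (V : Matrix.unitaryGroup (Fin n ⊕ Fin m → Bool) ℂ)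
    (out : Fin n ⊕ Fin m) :
    (adjoinAncillae n m)ᴴ * acceptReflection V out * adjoinAncillae n m =
      1 - (2 : ℂ) • ((acceptMap V out)ᴴ * acceptMap V out) := by
  have hD : (diagonal (fun x : Fin n ⊕ Fin m → Bool => if x out = true then (-1 : ℂ) else 1)) =
      1 - (2 : ℂ) • ((diagonal (fun x => if x out = true then (1 : ℂ) else 0))ᴴ *
        diagonal (fun x => if x out = true then 1 else 0)) := by
    rw [diagonal_conjTranspose, diagonal_mul_diagonal, ← diagonal_one, ← diagonal_smul,
      diagonal_sub]
    congr 1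
    ext x
    by_cases h : x out = true <;> simp [h]
    norm_num
  rw [acceptReflection, acceptMap, hD, conjTranspose_mul, conjTranspose_mul, Matrix.mul_sub,
    Matrix.sub_mul, Matrix.mul_sub, Matrix.sub_mul, Matrix.mul_one,
    Matrix.mem_unitaryGroup_iff'.1 V.2, Matrix.mul_one, conjTranspose_adjoinAncillae_mul_self]
  simp only [Matrix.mul_smul, Matrix.smul_mul, Matrix.mul_assoc, star_eq_conjTranspose]

theorem sum_norm_sq_unitary_mulVec {K : Type*} [Fintype K] [DecidableEq K]
    (V : Matrix.unitaryGroup K ℂ) (v : K → ℂ) : ∑ x, ‖(V.1 *ᵥ v) x‖ ^ 2 = ∑ x, ‖v x‖ ^ 2 := by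
  have h : ∀ w : K → ℂ, ((∑ x, ‖w x‖ ^ 2 : ℝ) : ℂ) = star w ⬝ᵥ w := fun w => by
    rw [dotProduct]
    push_cast
    refine Finset.sum_congr rfl fun x _ => ?_
    rw [← Complex.conj_mul']
    rfl
  apply Complex.ofReal_injective
  rw [h, h, star_mulVec, dotProduct_mulVec, vecMul_vecMul, ← star_eq_conjTranspose,
    Matrix.mem_unitaryGroup_iff'.1 V.2, vecMul_one]

theorem acceptProb_nonneg (V : Verifier n m) (ψ : EuclideanSpace ℂ (Fin n → Bool)) :
    0 ≤ V.acceptProb ψ :=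
  Finset.sum_nonneg fun x _ => by split_ifs <;> positivity

theorem sum_norm_sq_withAncillae (ψ : EuclideanSpace ℂ (Fin n → Bool)) :
    ∑ x, ‖withAncillae m ψ x‖ ^ 2 = ‖ψ‖ ^ 2 := by
  rw [EuclideanSpace.norm_sq_eq]
  symm
  refine Fintype.sum_of_injective (fun y => Sum.elim y fun _ => false) ?_ _ _ ?_ ?_
  · intro y y' h
    ext i
    exact congrFun h (Sum.inl i)
  · intro x hx
    have : ¬∀ j, x (Sum.inr j) = false := by
      intro h
      apply hx
      refine ⟨fun i => x (Sum.inl i), ?_⟩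
      ext (i | j)
      · rfl
      · exact (h j).symm
    simp [withAncillae, this]
  · intro y
    simp [withAncillae]

theorem acceptProb_le_one (V : Verifier n m) {ψ : EuclideanSpace ℂ (Fin n → Bool)}
    (hψ : ‖ψ‖ = 1) : V.acceptProb ψ ≤ 1 := by
  have h : ∑ x, ‖(V.U.1 *ᵥ withAncillae m ψ) x‖ ^ 2 = 1 := by
    rw [sum_norm_sq_unitary_mulVec, sum_norm_sq_withAncillae, hψ, one_pow]
  rw [← h]
  refine Finset.sum_le_sum fun x _ => ?_
  split_ifs
  · exact le_rfl
  · positivity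

/-- Simultaneous diagonalisation of the acceptance probability of a verifier and of the weight of
`P(W) |ψ⟩|0…0⟩`, for `W` the walk operator. -/
theorem exists_eigenbasis_acceptProb (V : Matrix.unitaryGroup (Fin n ⊕ Fin m → Bool) ℂ)
    (out : Fin n ⊕ Fin m) :
    ∃ (B : OrthonormalBasis (Fin n → Bool) ℂ (EuclideanSpace ℂ (Fin n → Bool)))
      (φ : (Fin n → Bool) → ℝ), (∀ i, |φ i| ≤ Real.pi) ∧
      (∀ ψ, (Verifier.mk V out).acceptProb ψ =
        ∑ i, (1 + Real.cos (φ i)) / 2 * ‖inner ℂ (B i) ψ‖ ^ 2) ∧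
      ∀ (P : ℂ[X]) (ψ : EuclideanSpace ℂ (Fin n → Bool)),
        ∑ x, ‖(aeval (verifierWalk V out) P *ᵥ withAncillae m ψ) x‖ ^ 2 =
          ∑ i, (‖P.eval (Complex.exp (φ i * Complex.I))‖ ^ 2 +
            ‖P.eval (Complex.exp ((-φ i : ℝ) * Complex.I))‖ ^ 2) / 2 *
              ‖inner ℂ (B i) ψ‖ ^ 2 := by
  have hA : ((acceptMap V out)ᴴ * acceptMap V out).IsHermitian :=
    isHermitian_conjTranspose_mul_self _
  set B := hA.eigenvectorBasis with hB
  have hBe : ∀ i, ((acceptMap V out)ᴴ * acceptMap V out) *ᵥ (B i).ofLp =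
      ((hA.eigenvalues i : ℝ) : ℂ) • (B i).ofLp := fun i => by
    rw [hB, hA.mulVec_eigenvectorBasis i]
    rfl
  have hacc : ∀ ψ, (Verifier.mk V out).acceptProb ψ =
      ∑ i, hA.eigenvalues i * ‖inner ℂ (B i) ψ‖ ^ 2 := fun ψ => by
    rw [acceptProb_eq]
    exact sum_norm_sq_mulVec_of_eigenbasis _ B _ hBe ψ
  have hev : ∀ i, (Verifier.mk V out).acceptProb (B i) = hA.eigenvalues i := fun i => by
    rw [hacc, Finset.sum_eq_single i]
    · simp [B.orthonormal.1 i]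
    · intro j _ hj
      rw [B.orthonormal.2 hj]; simp
    · simp
  have hcos : ∀ i, (1 + Real.cos (Real.arccos (2 * hA.eigenvalues i - 1))) / 2 =
      hA.eigenvalues i := fun i => by
    have h0 := acceptProb_nonneg (Verifier.mk V out) (B i)
    have h1 := acceptProb_le_one (Verifier.mk V out) (B.orthonormal.1 i)
    rw [hev] at h0 h1
    rw [Real.cos_arccos (by linarith) (by linarith)]
    ring
  refine ⟨B, fun i => Real.arccos (2 * hA.eigenvalues i - 1), fun i => ?_, fun ψ => ?_,
    fun P ψ => ?_⟩
  · rw [abs_of_nonneg (Real.arccos_nonneg _)]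
    exact Real.arccos_le_pi _
  · simp only [hcos]
    exact hacc ψ
  · rw [← adjoinAncillae_mulVec, mulVec_mulVec]
    refine sum_norm_sq_mulVec_of_eigenbasis _ B _ (fun i => ?_) ψ
    refine compression_aeval_walk conjTranspose_adjoinAncillae_mul_self
      (conjTranspose_acceptReflection V out) (acceptReflection_mul_self V out)
      (compression_acceptReflection V out) ?_ P
    rw [hcos]
    exact hBe i

theorem sum_norm_sq_inner_eq_one {ι E : Type*} [Fintype ι] [NormedAddCommGroup E]
    [InnerProductSpace ℂ E] (B : OrthonormalBasis ι ℂ E) {ψ : E} (hψ : ‖ψ‖ = 1) :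
    ∑ i, ‖inner ℂ (B i) ψ‖ ^ 2 = 1 := by
  rw [B.sum_sq_norm_inner_right, hψ, one_pow]

theorem exists_witness_of_acceptsWith {V : Matrix.unitaryGroup (Fin n ⊕ Fin m → Bool) ℂ}
    {out : Fin n ⊕ Fin m} {P : ℂ[X]} {a ε : ℝ}
    (hP : ∀ φ : ℝ, |φ| ≤ Real.pi → a ≤ (1 + Real.cos φ) / 2 →
      1 - ε ≤ ‖P.eval (Complex.exp (φ * Complex.I))‖ ^ 2)
    (hV : (Verifier.mk V out).AcceptsWith a) :
    ∃ ψ : EuclideanSpace ℂ (Fin n → Bool), ‖ψ‖ = 1 ∧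
      1 - ε ≤ ∑ x, ‖(aeval (verifierWalk V out) P *ᵥ withAncillae m ψ) x‖ ^ 2 := by
  obtain ⟨B, φ, hφ, hacc, hamp⟩ := exists_eigenbasis_acceptProb V out
  obtain ⟨ψ, hψ, haψ⟩ := hV
  have hex : ∃ i, a ≤ (1 + Real.cos (φ i)) / 2 := by
    by_contra! hlt
    have hsum := sum_norm_sq_inner_eq_one B hψ
    obtain ⟨i, -, hi⟩ : ∃ i ∈ Finset.univ, ‖inner ℂ (B i) ψ‖ ^ 2 ≠ 0 :=
      Finset.exists_ne_zero_of_sum_ne_zero (by rw [hsum]; exact one_ne_zero)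
    have : (Verifier.mk V out).acceptProb ψ < a := by
      calc (Verifier.mk V out).acceptProb ψ
          = ∑ i, (1 + Real.cos (φ i)) / 2 * ‖inner ℂ (B i) ψ‖ ^ 2 := hacc ψ
        _ < ∑ i, a * ‖inner ℂ (B i) ψ‖ ^ 2 := by
          refine Finset.sum_lt_sum
            (fun j _ => mul_le_mul_of_nonneg_right (hlt j).le (by positivity))
            ⟨i, Finset.mem_univ i, mul_lt_mul_of_pos_right (hlt i) (by positivity)⟩
        _ = a := by rw [← Finset.mul_sum, hsum, mul_one]
    linarith
  obtain ⟨i, hi⟩ := hex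
  refine ⟨B i, B.orthonormal.1 i, ?_⟩
  rw [hamp, Finset.sum_eq_single i]
  · have h1 := hP (φ i) (hφ i) hi
    have h2 := hP (-φ i) (by rw [abs_neg]; exact hφ i) (by rwa [Real.cos_neg])
    have h3 : ‖inner ℂ (B i) (B i)‖ ^ 2 = 1 := by simp [B.orthonormal.1 i]
    rw [h3, mul_one]
    linarith
  · intro j _ hj
    rw [B.orthonormal.2 hj]; simp
  · simp

theorem le_of_soundWith {V : Matrix.unitaryGroup (Fin n ⊕ Fin m → Bool) ℂ}
    {out : Fin n ⊕ Fin m} {P : ℂ[X]} {b ε : ℝ}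
    (hP : ∀ φ : ℝ, |φ| ≤ Real.pi → (1 + Real.cos φ) / 2 ≤ b →
      ‖P.eval (Complex.exp (φ * Complex.I))‖ ^ 2 ≤ ε)
    (hV : (Verifier.mk V out).SoundWith b) {ψ : EuclideanSpace ℂ (Fin n → Bool)}
    (hψ : ‖ψ‖ = 1) :
    ∑ x, ‖(aeval (verifierWalk V out) P *ᵥ withAncillae m ψ) x‖ ^ 2 ≤ ε := by
  obtain ⟨B, φ, hφ, hacc, hamp⟩ := exists_eigenbasis_acceptProb V out
  have hle : ∀ i, (1 + Real.cos (φ i)) / 2 ≤ b := fun i => by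
    have h := hV (B i) (B.orthonormal.1 i)
    rw [hacc, Finset.sum_eq_single i] at h
    · simpa [B.orthonormal.1 i] using h
    · intro j _ hj
      rw [B.orthonormal.2 hj]; simp
    · simp
  rw [hamp]
  calc _ ≤ ∑ i, ε * ‖inner ℂ (B i) ψ‖ ^ 2 := by
        refine Finset.sum_le_sum fun i _ => mul_le_mul_of_nonneg_right ?_ (by positivity)
        have h1 := hP (φ i) (hφ i) (hle i)
        have h2 := hP (-φ i) (by rw [abs_neg]; exact hφ i) (by rw [Real.cos_neg]; exact hle i)
        linarith
    _ = ε := by rw [← Finset.mul_sum, sum_norm_sq_inner_eq_one B hψ, mul_one]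

end VerifierWalk

/-! ### The action of circuits on state vectors -/

theorem extend_comp_self {S R : Type*} (e : S ↪ R) (x : R → Bool) :
    Function.extend e (x ∘ e) x = x := by
  funext w
  by_cases hw : ∃ s, e s = w
  · obtain ⟨s, rfl⟩ := hw
    exact e.injective.extend_apply _ _ _
  · exact Function.extend_apply' _ _ _ hw

/-- The Toffoli-like involution that flips the third bit if the first is `1` and the second `0`. -/
def toffoliFlip (x : Fin 3 → Bool) : Fin 3 → Bool :=
  Function.update x 2 (xor (x 2) (x 0 && !x 1))

theorem toffoliFlip_involutive : Function.Involutive toffoliFlip := by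
  intro x
  ext i
  fin_cases i <;> simp [toffoliFlip]

/-- The embedding of three distinct qubits. -/
def threeQubits {R : Type} {u a f : R} (hua : u ≠ a) (huf : u ≠ f) (haf : a ≠ f) : Fin 3 ↪ R :=
  ⟨![u, a, f], by
    intro i j h
    fin_cases i <;> fin_cases j <;> simp_all⟩

theorem extend_toffoliFlip {R : Type} [DecidableEq R] {u a f : R} (hua : u ≠ a) (huf : u ≠ f) (haf : a ≠ f)
    (x : R → Bool) :
    Function.extend (threeQubits hua huf haf) (toffoliFlip (x ∘ threeQubits hua huf haf)) x =
      Function.update x f (xor (x f) (x u && !x a)) := by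
  set e := threeQubits hua huf haf
  have h0 : e 0 = u := rfl
  have h1 : e 1 = a := rfl
  have h2 : e 2 = f := rfl
  have hext : ∀ i, Function.extend e (toffoliFlip (x ∘ e)) x (e i) = toffoliFlip (x ∘ e) i :=
    fun i => e.injective.extend_apply _ _ _
  funext w
  by_cases hw : ∃ i, e i = w
  · obtain ⟨i, rfl⟩ := hw
    rw [hext]
    have hi : i = 0 ∨ i = 1 ∨ i = 2 := by fin_cases i <;> simp
    rcases hi with rfl | rfl | rfl
    · simp [toffoliFlip, h0, huf]
    · simp [toffoliFlip, h1, haf]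
    · simp [toffoliFlip, h0, h1, h2]
  · rw [Function.extend_apply' _ _ _ hw, Function.update_of_ne]
    rintro rfl
    exact hw ⟨2, rfl⟩

section Gates

variable {S R : Type} [Fintype S] [DecidableEq S] [Fintype R] [DecidableEq R]

theorem onQubits_mulVec (e : S ↪ R) (A : Matrix (S → Bool) (S → Bool) ℂ) (Ψ : (R → Bool) → ℂ)
    (x : R → Bool) :
    (onQubits e A *ᵥ Ψ) x = ∑ t, A (x ∘ e) t * Ψ (Function.extend e t x) := by
  have hcomp : ∀ t : S → Bool, Function.extend e t x ∘ e = t := fun t =>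
    Function.extend_comp e.injective t x
  have hoff : ∀ (t : S → Bool) (w : R), (∀ s, e s ≠ w) → x w = Function.extend e t x w :=
    fun t w hw => (Function.extend_apply' _ _ _ (by rintro ⟨s, hs⟩; exact hw s hs)).symm
  rw [mulVec, dotProduct]
  symm
  refine Fintype.sum_of_injective (fun t => Function.extend e t x) ?_ _ _ ?_ ?_
  · intro t t' h
    rw [← hcomp t, ← hcomp t']
    exact congrArg (fun g => g ∘ e) h
  · intro z hz
    rw [onQubits, if_neg, zero_mul]
    intro h
    apply hz
    refine ⟨z ∘ e, funext fun w => ?_⟩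
    by_cases hw : ∃ s, e s = w
    · obtain ⟨s, rfl⟩ := hw
      exact congrFun (hcomp (z ∘ e)) s
    · have hw' : ∀ s, e s ≠ w := fun s hs => hw ⟨s, hs⟩
      exact (hoff _ w hw').symm.trans (h w hw')
  · intro t
    simp only [onQubits, if_pos (hoff t), hcomp]

theorem onQubits_diagonal_mulVec (e : S ↪ R) (d : (S → Bool) → ℂ) (Ψ : (R → Bool) → ℂ)
    (x : R → Bool) : (onQubits e (diagonal d) *ᵥ Ψ) x = d (x ∘ e) * Ψ x := by
  rw [onQubits_mulVec, Finset.sum_eq_single (x ∘ e), diagonal_apply_eq, extend_comp_self]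
  · intro t _ ht
    rw [diagonal_apply_ne _ ht.symm, zero_mul]
  · simp

theorem circuitUnitary_cons_mulVec (V : Matrix.unitaryGroup (S → Bool) ℂ) (s : Step S R)
    (l : List (Step S R)) (Ψ : (R → Bool) → ℂ) :
    (circuitUnitary V (s :: l)).1 *ᵥ Ψ = (circuitUnitary V l).1 *ᵥ ((s.unitary V).1 *ᵥ Ψ) := by
  rw [mulVec_mulVec]; rfl

theorem circuitUnitary_nil_mulVec (V : Matrix.unitaryGroup (S → Bool) ℂ) (Ψ : (R → Bool) → ℂ) :
    (circuitUnitary V ([] : List (Step S R))).1 *ᵥ Ψ = Ψ :=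
  one_mulVec Ψ

theorem circuitUnitary_append_mulVec (V : Matrix.unitaryGroup (S → Bool) ℂ)
    (l l' : List (Step S R)) (Ψ : (R → Bool) → ℂ) :
    (circuitUnitary V (l ++ l')).1 *ᵥ Ψ =
      (circuitUnitary V l').1 *ᵥ ((circuitUnitary V l).1 *ᵥ Ψ) := by
  induction l generalizing Ψ with
  | nil => rw [List.nil_append, circuitUnitary_nil_mulVec]
  | cons s l ih => rw [List.cons_append, circuitUnitary_cons_mulVec, ih,
      circuitUnitary_cons_mulVec]

/-- The diagonal gate that changes the sign of the basis states satisfying `g`. -/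
def signGate {k : ℕ} (g : (Fin k → Bool) → Bool) : Matrix.unitaryGroup (Fin k → Bool) ℂ :=
  ⟨diagonal fun x => if g x = true then -1 else 1, by
    rw [Matrix.mem_unitaryGroup_iff, star_eq_conjTranspose, diagonal_conjTranspose,
      diagonal_mul_diagonal, ← diagonal_one]
    congr 1
    ext x
    by_cases h : g x = true <;> simp [h]⟩

/-- The gate that permutes the basis states by an involution. -/
def permGate {k : ℕ} (τ : (Fin k → Bool) → (Fin k → Bool)) (hτ : Function.Involutive τ) :
    Matrix.unitaryGroup (Fin k → Bool) ℂ :=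
  ⟨Matrix.of fun x y => if y = τ x then 1 else 0, by
    rw [Matrix.mem_unitaryGroup_iff]
    ext x y
    rw [Matrix.mul_apply, Matrix.one_apply, Finset.sum_eq_single (τ x)]
    · simp [Matrix.star_apply, hτ.injective.eq_iff]
    · intro z _ hz
      simp [hz]
    · simp⟩

/-- A gate on one qubit. -/
def qubitGate (G : Matrix.unitaryGroup Bool ℂ) : Matrix.unitaryGroup (Fin 1 → Bool) ℂ :=
  ⟨G.1.submatrix (Equiv.funUnique (Fin 1) Bool) (Equiv.funUnique (Fin 1) Bool), by
    rw [Matrix.mem_unitaryGroup_iff, star_eq_conjTranspose, conjTranspose_submatrix,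
      submatrix_mul_equiv, ← star_eq_conjTranspose, Matrix.mem_unitaryGroup_iff.1 G.2,
      submatrix_one_equiv]⟩

theorem onQubits_permGate_mulVec {k : ℕ} (e : Fin k ↪ R) (τ : (Fin k → Bool) → (Fin k → Bool))
    (hτ : Function.Involutive τ) (Ψ : (R → Bool) → ℂ) (x : R → Bool) :
    (onQubits e (permGate τ hτ).1 *ᵥ Ψ) x = Ψ (Function.extend e (τ (x ∘ e)) x) := by
  rw [onQubits_mulVec, Finset.sum_eq_single (τ (x ∘ e))]
  · simp [permGate]
  · intro t _ ht
    simp [permGate, ht]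
  · simp

/-! ### A controlled reflection about the all-zero state -/

/-- A circuit that changes the sign exactly where `u` is `1` and all qubits `anc j` are `0`. A
Toffoli-like gate writes the conjunction of the first two conditions to a flag, which takes the
place of `u` for the remaining qubits, and the same gate restores the flag at the end. Hence the
circuit acts diagonally, whatever the flags contain. -/
theorem exists_controlled_reflection {k : ℕ} (anc : Fin k → R) (flag : Fin k ↪ R)
    (hne : ∀ i j, anc i ≠ flag j) (js : List (Fin k)) (hjs : js.Nodup) (u : R)
    (hu : ∀ i, u ≠ anc i) (huf : ∀ j ∈ js, u ≠ flag j) :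
    ∃ l : List (Step S R), l.length = 2 * js.length + 1 ∧ (l.map Step.evals).sum = 0 ∧
      ∃ D : (R → Bool) → ℂ, (∀ V Ψ x, ((circuitUnitary V l).1 *ᵥ Ψ) x = D x * Ψ x) ∧
        ∀ x : R → Bool, (∀ j ∈ js, x (flag j) = false) →
          D x = if x u = true ∧ ∀ j ∈ js, x (anc j) = false then -1 else 1 := by
  induction js generalizing u with
  | nil =>
    refine ⟨[.gate 1 (by norm_num) ⟨fun _ => u, Function.injective_of_subsingleton _⟩
      (signGate fun y => y 0)], rfl, rfl, fun x => if x u = true then -1 else 1, ?_, ?_⟩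
    · intro V Ψ x
      rw [circuitUnitary_cons_mulVec, circuitUnitary_nil_mulVec]
      exact onQubits_diagonal_mulVec _ _ Ψ x
    · intro x _
      simp
  | cons j js ih =>
    obtain ⟨hj, hjs'⟩ := List.nodup_cons.1 hjs
    obtain ⟨l, hlen, hev, D, hD, hDx⟩ := ih hjs' (flag j) (fun i => (hne i j).symm)
      fun i hi h => hj (by rwa [flag.injective h])
    have huj : u ≠ flag j := huf j List.mem_cons_self
    set tof : Step S R := .gate 3 le_rfl (threeQubits (hu j) huj (hne j j))
      (permGate toffoliFlip toffoliFlip_involutive) with htof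
    set τ : (R → Bool) → (R → Bool) := fun x =>
      Function.update x (flag j) (xor (x (flag j)) (x u && !x (anc j))) with hτ
    have htofV : ∀ (V : Matrix.unitaryGroup (S → Bool) ℂ) (Ψ : (R → Bool) → ℂ) x,
        ((tof.unitary V).1 *ᵥ Ψ) x = Ψ (τ x) := by
      intro V Ψ x
      refine (onQubits_permGate_mulVec _ _ _ Ψ x).trans ?_
      rw [extend_toffoliFlip]
    have hττ : ∀ x, τ (τ x) = x := by
      intro x
      simp [hτ, Function.update_of_ne huj, Function.update_of_ne (hne j j)]
    refine ⟨tof :: (l ++ [tof]), by simp [hlen]; ring, by simp [hev, htof, Step.evals],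
      fun x => D (τ x), ?_, ?_⟩
    · intro V Ψ x
      rw [circuitUnitary_cons_mulVec, circuitUnitary_append_mulVec, circuitUnitary_cons_mulVec,
        circuitUnitary_nil_mulVec, htofV, hD, htofV, hττ]
    · intro x hx
      have hxj := hx j List.mem_cons_self
      have hτne : ∀ w, w ≠ flag j → τ x w = x w := fun w hw => Function.update_of_ne hw _ _
      have hτj : τ x (flag j) = (x u && !x (anc j)) := by
        simp [hτ, hxj]
      have hflags : ∀ i ∈ js, τ x (flag i) = false := fun i hi => by
        rw [hτne _ fun h => hj (by rwa [← flag.injective h])]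
        exact hx i (List.mem_cons_of_mem _ hi)
      have hancs : ∀ i, τ x (anc i) = x (anc i) := fun i => hτne _ (hne i j)
      simp only [hDx (τ x) hflags, hτj, hancs, List.forall_mem_cons, Bool.and_eq_true,
        Bool.not_eq_true', and_assoc]

end Gates

/-! ### Signal processing with a control qubit -/

/-- A register `R` that contains a system register `S`, a control qubit and `k` flag qubits, all
distinct. -/
structure Layout (S R : Type) (k : ℕ) where
  sys : S ↪ R
  ctrl : R
  flag : Fin k ↪ R
  sys_ne_ctrl : ∀ s, sys s ≠ ctrl
  sys_ne_flag : ∀ s j, sys s ≠ flag j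
  ctrl_ne_flag : ∀ j, ctrl ≠ flag j

section Branches

variable {S R : Type} [Fintype S] [DecidableEq S] [Fintype R] [DecidableEq R] {k : ℕ}

/-- The state in which all flags are `0` and the system is in the state `χ b` on the branch where
the control qubit is `b`. -/
def Layout.branches (E : Layout S R k) (χ : Bool → (S → Bool) → ℂ) : (R → Bool) → ℂ :=
  fun x => if ∀ j, x (E.flag j) = false then χ (x E.ctrl) (x ∘ E.sys) else 0

theorem Layout.onQubits_sys_mulVec (E : Layout S R k) (A : Matrix (S → Bool) (S → Bool) ℂ)
    (χ : Bool → (S → Bool) → ℂ) :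
    onQubits E.sys A *ᵥ E.branches χ = E.branches fun b => A *ᵥ χ b := by
  ext x
  have hflag : ∀ t j, Function.extend E.sys t x (E.flag j) = x (E.flag j) := fun t j =>
    Function.extend_apply' _ _ _ (by rintro ⟨s, hs⟩; exact E.sys_ne_flag s j hs)
  have hctrl : ∀ t, Function.extend E.sys t x E.ctrl = x E.ctrl := fun t =>
    Function.extend_apply' _ _ _ (by rintro ⟨s, hs⟩; exact E.sys_ne_ctrl s hs)
  simp only [onQubits_mulVec, branches, hflag, hctrl, Function.extend_comp E.sys.injective]
  split_ifs
  · rfl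
  · simp

/-- The step that applies a one-qubit gate to the control qubit. -/
def Layout.ctrlGate (E : Layout S R k) (G : Matrix.unitaryGroup Bool ℂ) : Step S R :=
  .gate 1 (by norm_num) ⟨fun _ => E.ctrl, Function.injective_of_subsingleton _⟩ (qubitGate G)

theorem Layout.ctrlGate_mulVec (E : Layout S R k) (G : Matrix.unitaryGroup Bool ℂ)
    (V : Matrix.unitaryGroup (S → Bool) ℂ) (χ : Bool → (S → Bool) → ℂ) :
    ((E.ctrlGate G).unitary V).1 *ᵥ E.branches χ =
      E.branches fun b => G.1 b false • χ false + G.1 b true • χ true := by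
  ext x
  set e : Fin 1 ↪ R := ⟨fun _ => E.ctrl, Function.injective_of_subsingleton _⟩ with he
  have hne : ∀ t w, w ≠ E.ctrl → Function.extend e t x w = x w := fun t w hw =>
    Function.extend_apply' _ _ _ (by rintro ⟨s, hs⟩; exact hw hs.symm)
  have hctrl : ∀ t, Function.extend e t x E.ctrl = t 0 := fun t =>
    e.injective.extend_apply t x 0
  have hflag : ∀ t j, Function.extend e t x (E.flag j) = x (E.flag j) := fun t j =>
    hne t _ (E.ctrl_ne_flag j).symm
  have hsys : ∀ t, Function.extend e t x ∘ E.sys = x ∘ E.sys := fun t =>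
    funext fun s => hne t _ (E.sys_ne_ctrl s)
  refine (onQubits_mulVec e (qubitGate G).1 (E.branches χ) x).trans ?_
  simp only [branches, hctrl, hflag, hsys]
  by_cases h : ∀ j, x (E.flag j) = false
  · simp only [h, implies_true, if_true]
    refine (Fintype.sum_equiv (Equiv.funUnique (Fin 1) Bool) _
      (fun b => G.1 (x E.ctrl) b * χ b (x ∘ E.sys)) (fun t => rfl)).trans ?_
    rw [Fintype.sum_bool, add_comm]
    rfl
  · simp [h]

end Branches

section Circuit

variable {n m : ℕ} {R : Type} [Fintype R] [DecidableEq R]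

/-- The walk operator, applied on the branch where the control qubit is `1`. Only the sign changes
need to be controlled: on the other branch the evaluations of the black box cancel. -/
theorem Layout.exists_controlled_walk (E : Layout (Fin n ⊕ Fin m) R m) (out : Fin n ⊕ Fin m) :
    ∃ l : List (Step (Fin n ⊕ Fin m) R), l.length = 2 * m + 4 ∧ (l.map Step.evals).sum = 2 ∧
      ∀ V χ, (circuitUnitary V l).1 *ᵥ E.branches χ =
        E.branches fun b => if b then verifierWalk V out *ᵥ χ true else χ false := by
  obtain ⟨l, hlen, hev, D, hD, hDx⟩ := exists_controlled_reflection (S := Fin n ⊕ Fin m)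
    (fun i => E.sys (Sum.inr i)) E.flag (fun i j => E.sys_ne_flag _ j) (List.finRange m)
    (List.nodup_finRange m) E.ctrl (fun i => (E.sys_ne_ctrl _).symm)
    fun j _ => E.ctrl_ne_flag j
  simp only [List.mem_finRange, true_implies] at hDx
  set e2 : Fin 2 ↪ R := ⟨![E.ctrl, E.sys out], by
    have := E.sys_ne_ctrl out
    intro i j h
    fin_cases i <;> fin_cases j <;> simp_all⟩ with he2
  set cz : Step (Fin n ⊕ Fin m) R :=
    .gate 2 (by norm_num) e2 (signGate fun y => y 0 && y 1) with hcz
  have hrefl : ∀ V χ, (circuitUnitary V l).1 *ᵥ E.branches χ = E.branches fun b => if b then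
      (1 - (2 : ℂ) • (adjoinAncillae n m * (adjoinAncillae n m)ᴴ)) *ᵥ χ true else χ false := by
    intro V χ
    ext x
    rw [hD, Layout.branches, Layout.branches]
    by_cases h : ∀ j, x (E.flag j) = false
    · rw [hDx x h, if_pos h, if_pos h, reflection_adjoinAncillae]
      by_cases hc : x E.ctrl = true
      · simp only [hc, true_and, if_true, mulVec_diagonal, Function.comp_apply]
      · simp [hc]
    · rw [if_neg h, if_neg h, mul_zero]
  have hczV : ∀ V χ, (cz.unitary V).1 *ᵥ E.branches χ = E.branches fun b => if b then
      diagonal (fun x : Fin n ⊕ Fin m → Bool => if x out = true then (-1 : ℂ) else 1) *ᵥ χ true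
      else χ false := by
    intro V χ
    ext x
    refine (onQubits_diagonal_mulVec e2 _ (E.branches χ) x).trans ?_
    have h0 : e2 0 = E.ctrl := rfl
    have h1 : e2 1 = E.sys out := rfl
    rw [Layout.branches, Layout.branches]
    by_cases h : ∀ j, x (E.flag j) = false
    · rw [if_pos h, if_pos h]
      by_cases hc : x E.ctrl = true
      · simp only [Function.comp_apply, h0, h1, hc, Bool.true_and, if_true, mulVec_diagonal]
      · simp [h0, hc]
    · rw [if_neg h, if_neg h, mul_zero]
  refine ⟨l ++ [.evalV E.sys, cz, .evalVdagger E.sys], by simp [hlen],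
    by simp [hev, hcz, Step.evals], fun V χ => ?_⟩
  have hV : star V.1 * V.1 = 1 := Matrix.mem_unitaryGroup_iff'.1 V.2
  rw [circuitUnitary_append_mulVec, hrefl, circuitUnitary_cons_mulVec, circuitUnitary_cons_mulVec,
    circuitUnitary_cons_mulVec, circuitUnitary_nil_mulVec]
  have h1 : ((Step.evalV E.sys).unitary V).1 = onQubits E.sys V.1 := rfl
  have h2 : ((Step.evalVdagger E.sys).unitary V).1 = onQubits E.sys (star V.1) := rfl
  rw [h1, h2, E.onQubits_sys_mulVec, hczV, E.onQubits_sys_mulVec]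
  congr 1
  ext b : 1
  cases b
  · simp [mulVec_mulVec, hV]
  · simp [mulVec_mulVec, verifierWalk, walk, acceptReflection, Matrix.mul_assoc]

/-- Generalised quantum signal processing: any complementary pair of polynomials in the walk
operator can be applied on the two branches of the control qubit. -/
theorem Layout.exists_signal_processing (E : Layout (Fin n ⊕ Fin m) R m) (out : Fin n ⊕ Fin m)
    (d : ℕ) : ∀ p q : ℂ[X], p.natDegree ≤ d → q.natDegree ≤ d →
    (∀ z : ℂ, ‖z‖ = 1 → ‖p.eval z‖ ^ 2 + ‖q.eval z‖ ^ 2 = 1) →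
    ∃ l : List (Step (Fin n ⊕ Fin m) R), l.length = d * (2 * m + 5) + 1 ∧
      (l.map Step.evals).sum = 2 * d ∧
      ∀ V v, (circuitUnitary V l).1 *ᵥ E.branches (fun b => if b then 0 else v) =
        E.branches fun b => if b then aeval (verifierWalk V out) q *ᵥ v
          else aeval (verifierWalk V out) p *ᵥ v := by
  induction d with
  | zero =>
    intro p q hp hq hpq
    have hpC := eq_C_of_natDegree_le_zero hp
    have hqC := eq_C_of_natDegree_le_zero hq
    set s := p.coeff 0
    set t := q.coeff 0
    have hst : s * conj s + t * conj t = 1 := by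
      have h := hpq 1 (by simp)
      rw [hpC, hqC, eval_C, eval_C] at h
      rw [Complex.mul_conj', Complex.mul_conj']
      exact_mod_cast h
    set G : Matrix Bool Bool ℂ := Matrix.of fun i j =>
      if i then (if j then conj s else t) else (if j then -conj t else s) with hG
    have hGu : G ∈ Matrix.unitaryGroup Bool ℂ := by
      rw [Matrix.mem_unitaryGroup_iff]
      ext i j
      rcases i with _ | _ <;> rcases j with _ | _ <;>
        simp [G, Matrix.mul_apply, Matrix.star_apply] <;>
        first | linear_combination hst | ring
    refine ⟨[E.ctrlGate ⟨G, hGu⟩], by simp, by simp [Layout.ctrlGate, Step.evals],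
      fun V v => ?_⟩
    rw [circuitUnitary_cons_mulVec, circuitUnitary_nil_mulVec, E.ctrlGate_mulVec, hpC, hqC]
    congr 1
    ext b : 1
    cases b <;> simp [hG, Algebra.algebraMap_eq_smul_one, smul_mulVec]
  | succ d ih =>
    intro p q hp hq hpq
    obtain ⟨G, p', q', hp', hq', hpq', hpe, hqe⟩ := exists_rotation_peeling hp hq hpq
    obtain ⟨l, hlen, hev, hl⟩ := ih p' q' hp' hq' hpq'
    obtain ⟨w, hwlen, hwev, hw⟩ := E.exists_controlled_walk out
    refine ⟨l ++ (w ++ [E.ctrlGate G]), by simp [hlen, hwlen]; ring,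
      by simp [hev, hwev, Layout.ctrlGate, Step.evals]; ring, fun V v => ?_⟩
    rw [circuitUnitary_append_mulVec, circuitUnitary_append_mulVec, hl, hw,
      circuitUnitary_cons_mulVec, circuitUnitary_nil_mulVec, E.ctrlGate_mulVec]
    congr 1
    ext b : 1
    conv_rhs => rw [hpe, hqe]
    cases b <;> simp [Algebra.algebraMap_eq_smul_one, smul_mulVec, add_mulVec, mulVec_mulVec]

/-! ### The amplified verifier -/

/-- The register of the amplified verifier: its ancillae are those of the black box, the control
qubit, and one flag for each ancilla of the black box. -/
def amplifierLayout (n m : ℕ) : Layout (Fin n ⊕ Fin m) (Fin n ⊕ Fin (m + (1 + m))) m where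
  sys := ⟨Sum.map id (Fin.castAdd (1 + m)),
    Function.Injective.sumMap Function.injective_id (Fin.castAdd_injective m (1 + m))⟩
  ctrl := Sum.inr (Fin.natAdd m (Fin.castAdd m 0))
  flag := ⟨fun j => Sum.inr (Fin.natAdd m (Fin.natAdd 1 j)), fun i j h => by
    simpa [Fin.ext_iff] using h⟩
  sys_ne_ctrl := by
    rintro (i | j) h
    · exact Sum.inl_ne_inr h
    · have hval := congrArg Fin.val (Sum.inr.inj h)
      simp only [Fin.val_castAdd, Fin.val_natAdd] at hval
      omega
  sys_ne_flag := by
    rintro (i | j) k h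
    · exact Sum.inl_ne_inr h
    · have hval := congrArg Fin.val (Sum.inr.inj h)
      simp only [Fin.val_castAdd, Fin.val_natAdd] at hval
      omega
  ctrl_ne_flag := by
    intro j h
    have hval := congrArg Fin.val (Sum.inr.inj h)
    simp only [Fin.val_castAdd, Fin.val_natAdd] at hval
    omega

theorem amplifierLayout_cases {motive : Fin n ⊕ Fin (m + (1 + m)) → Prop}
    (hsys : ∀ s, motive ((amplifierLayout n m).sys s)) (hctrl : motive (amplifierLayout n m).ctrl)
    (hflag : ∀ j, motive ((amplifierLayout n m).flag j)) (w) : motive w := by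
  rcases w with i | j
  · exact hsys (Sum.inl i)
  · refine Fin.addCases (fun j => hsys (Sum.inr j)) (fun j => ?_) j
    refine Fin.addCases (fun j => ?_) (fun j => hflag j) j
    rw [Subsingleton.elim j 0]
    exact hctrl

theorem withAncillae_eq_branches (ψ : EuclideanSpace ℂ (Fin n → Bool)) :
    withAncillae (m + (1 + m)) ψ =
      (amplifierLayout n m).branches fun b => if b then 0 else withAncillae m ψ := by
  ext x
  have hiff : (∀ j, x (Sum.inr j) = false) ↔ (∀ j, x ((amplifierLayout n m).flag j) = false) ∧
      x (amplifierLayout n m).ctrl = false ∧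
      ∀ j, x ((amplifierLayout n m).sys (Sum.inr j)) = false := by
    constructor
    · exact fun h => ⟨fun j => h _, h _, fun j => h _⟩
    · rintro ⟨h1, h2, h3⟩ j
      refine Fin.addCases (fun j => h3 j) (fun j => ?_) j
      refine Fin.addCases (fun j => ?_) (fun j => h1 j) j
      rw [Subsingleton.elim j 0]
      exact h2
  rw [withAncillae, Layout.branches]
  simp only [hiff]
  by_cases h1 : ∀ j, x ((amplifierLayout n m).flag j) = false
  · by_cases h2 : x (amplifierLayout n m).ctrl = false
    · simp only [h1, h2, implies_true, true_and, if_true, Bool.false_eq_true, if_false]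
      rfl
    · simp [h1, h2]
  · simp [h1]

/-- The probability of measuring `1` on the control qubit is the weight of that branch. -/
theorem sum_branches_ctrl (χ : Bool → (Fin n ⊕ Fin m → Bool) → ℂ) :
    (∑ x, if x (amplifierLayout n m).ctrl = true then
      ‖(amplifierLayout n m).branches χ x‖ ^ 2 else 0) = ∑ y, ‖χ true y‖ ^ 2 := by
  set E := amplifierLayout n m with hE
  set f : (Fin n ⊕ Fin m → Bool) → (Fin n ⊕ Fin (m + (1 + m)) → Bool) := fun y =>
    Function.extend E.sys y fun w => decide (w = E.ctrl) with hf
  have hsys : ∀ y, f y ∘ E.sys = y := fun y => Function.extend_comp E.sys.injective _ _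
  have hctrl : ∀ y, f y E.ctrl = true := fun y => by
    rw [hf]
    simp only
    rw [Function.extend_apply' _ _ _ (by rintro ⟨s, hs⟩; exact E.sys_ne_ctrl s hs)]
    simp
  have hflag : ∀ y j, f y (E.flag j) = false := fun y j => by
    rw [hf]
    simp only
    rw [Function.extend_apply' _ _ _ (by rintro ⟨s, hs⟩; exact E.sys_ne_flag s j hs)]
    simpa using (E.ctrl_ne_flag j).symm
  symm
  refine Fintype.sum_of_injective f ?_ _ _ ?_ ?_
  · intro y y' h
    rw [← hsys y, h, hsys]
  · intro x hx
    by_cases h1 : x E.ctrl = true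
    · by_cases h2 : ∀ j, x (E.flag j) = false
      · refine absurd ⟨x ∘ E.sys, funext fun w => ?_⟩ hx
        refine amplifierLayout_cases (motive := fun w => f (x ∘ E.sys) w = x w) (fun s => ?_) ?_ (fun j => ?_) w
        · exact congrFun (hsys (x ∘ E.sys)) s
        · exact (hctrl _).trans h1.symm
        · exact (hflag _ j).trans (h2 j).symm
      · simp [Layout.branches, h2]
    · simp [h1]
  · intro y
    simp [Layout.branches, hctrl, hflag, hsys]

/-- For every complementary pair of polynomials there is an oracle circuit that accepts with
probability the squared norm of `P(W) |ψ⟩|0…0⟩`, where `W` is the walk operator of the black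
box. -/
theorem exists_oracleVerifier (out : Fin n ⊕ Fin m) {d : ℕ} {P Q : ℂ[X]} (hP : P.natDegree ≤ d)
    (hQ : Q.natDegree ≤ d)
    (hPQ : ∀ z : ℂ, ‖z‖ = 1 → ‖P.eval z‖ ^ 2 + ‖Q.eval z‖ ^ 2 = 1) :
    ∃ T : OracleVerifier n m (m + (1 + m)), T.size = d * (2 * m + 5) + 1 ∧
      T.evaluations = 2 * d ∧
      ∀ V ψ, (T.instantiate V).acceptProb ψ =
        ∑ x, ‖(aeval (verifierWalk V out) P *ᵥ withAncillae m ψ) x‖ ^ 2 := by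
  obtain ⟨l, hlen, hev, hl⟩ := (amplifierLayout n m).exists_signal_processing out d Q P hQ hP
    fun z hz => by rw [add_comm]; exact hPQ z hz
  refine ⟨⟨l, (amplifierLayout n m).ctrl⟩, hlen, hev, fun V ψ => ?_⟩
  rw [Verifier.acceptProb, OracleVerifier.instantiate]
  simp only [withAncillae_eq_branches (m := m), hl]
  rw [sum_branches_ctrl]
  rfl

end Circuit

end QMA

theorem theorem1 :
    ∃ C d : ℕ, ∀ (n m : ℕ) (out : Fin n ⊕ Fin m) (a b : ℝ) (r : ℕ),
      0 ≤ b → b < a → a ≤ 1 →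
      ∃ (m' : ℕ) (T : QMA.OracleVerifier n m m'),
        (m' : ℝ) ≤ C * ((n : ℝ) + m + r + 1 / (a - b)) ^ d ∧
        (T.size : ℝ) ≤ C * ((n : ℝ) + m + r + 1 / (a - b)) ^ d ∧
        (T.evaluations : ℝ) ≤ 10 * Real.pi * (Real.sqrt a + Real.sqrt b) * r / (a - b) ∧
        ∀ V : Matrix.unitaryGroup (Fin n ⊕ Fin m → Bool) ℂ,
          ((QMA.Verifier.mk V out).AcceptsWith a →
            (T.instantiate V).AcceptsWith (1 - Real.exp (-(r : ℝ)))) ∧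
          ((QMA.Verifier.mk V out).SoundWith b →
            (T.instantiate V).SoundWith (Real.exp (-(r : ℝ)))) := by
  refine ⟨300, 3, fun n m out a b r hb hba ha => ?_⟩
  obtain ⟨d, P, Q, hP, hQ, hd, hPQ, hacc, hrej⟩ := QMA.exists_amplifying_polynomials hb hba ha r
  obtain ⟨T, hsize, heval, hT⟩ := QMA.exists_oracleVerifier out hP hQ hPQ
  set y : ℝ := 1 / (a - b) with hy
  set x : ℝ := (n : ℝ) + m + r + y with hx
  have hab : 0 < a - b := sub_pos.2 hba
  have hy1 : 1 ≤ y := by rw [hy, le_div_iff₀ hab]; linarith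
  have hn0 : (0 : ℝ) ≤ n := Nat.cast_nonneg n
  have hm0 : (0 : ℝ) ≤ m := Nat.cast_nonneg m
  have hr0 : (0 : ℝ) ≤ r := Nat.cast_nonneg r
  have hx1 : 1 ≤ x := by linarith
  have hmx : (m : ℝ) ≤ x := by linarith
  have hx2 : 1 ≤ x ^ 2 := one_le_pow₀ hx1
  have hx3 : x ≤ x ^ 3 := le_self_pow₀ hx1 (by norm_num)
  have hd' : (d : ℝ) ≤ 40 * x ^ 2 := by
    have hsum : Real.sqrt a + Real.sqrt b ≤ 2 := by
      linarith [Real.sqrt_le_one.2 ha, Real.sqrt_le_one.2 (hba.le.trans ha)]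
    have h1 : 10 * Real.pi * (Real.sqrt a + Real.sqrt b) * r / (a - b) ≤
        10 * 4 * 2 * r / (a - b) := by
      have := Real.pi_le_four
      gcongr
    have h2 : 10 * 4 * 2 * (r : ℝ) / (a - b) = 80 * (r * y) := by rw [hy]; ring
    have h3 : r * y ≤ x ^ 2 := by
      rw [sq]
      exact mul_le_mul (by linarith) (by linarith) (by linarith) (by linarith)
    linarith
  refine ⟨m + (1 + m), T, ?_, ?_, ?_, fun V => ⟨fun hV => ?_, fun hV ψ hψ => ?_⟩⟩
  · push_cast
    linarith
  · rw [hsize]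
    push_cast
    have h1 : (d : ℝ) * (2 * m + 5) ≤ 40 * x ^ 2 * (7 * x) := by
      gcongr
      linarith
    have h2 : 40 * x ^ 2 * (7 * x) = 280 * x ^ 3 := by ring
    linarith
  · rw [heval]
    push_cast
    exact hd
  · obtain ⟨ψ, hψ, h⟩ := QMA.exists_witness_of_acceptsWith hacc hV
    exact ⟨ψ, hψ, by rwa [hT]⟩
  · rw [hT]
    exact QMA.le_of_soundWith hrej hV hψ
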